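/- Entropies are to base $2$. For $\mathsf x,\mathsf z\in\mathbb F_2$ let $|\psi(\mathsf x,\mathsf z)\rangle=\frac1{\sqrt2}\big(|0\rangle|0+\mathsf x\rangle+(-1)^{\mathsf z}|1\rangle|1+\mathsf x\rangle\big)$ be the Bell states; a state $\sum P(\mathsf x,\mathsf z)|\psi(\mathsf x,\mathsf z)\rangle\langle\psi(\mathsf x,\mathsf z)|$ with a probability distribution $P$ is called Bell diagonal. With the Pauli operators $\mathsf{XZ}(\mathsf s,\mathsf t)=X^{\mathsf s}Z^{\mathsf t}$, the discrete twirl of a two-qubit operator $\sigma$ is $\hat\sigma=\frac14\sum_{\mathsf s,\mathsf t\in\mathbb F_2}\mathsf{XZ}(\mathsf s,\mathsf t)^{\otimes2}\,\sigma\,\mathsf{XZ}(\mathsf s,\mathsf t)^{\otimes 2}$. For a two-qubit density operator $\sigma=\sigma_{AB}$ with a finite-dimensional purification $\sigma_{ABE}$, measure $A$ and $B$ of both copies in $\sigma_{ABE}^{\otimes2}$ in the computational basis. This gives bits $X_1,X_2$ (Alice), $Y_1,Y_2$ (Bob) and the quantum systems $E_1,E_2$. Put $U_1=X_1+X_2$,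 $V_1=Y_1+Y_2$, $W_1=U_1+V_1$; if $W_1=0$ put $U_2=X_2$, $V_2=Y_2$, and if $W_1=1$ put $U_2=V_2=0$; put $W_2=U_2+V_2$. Write $H_\sigma(A|B)=H(\sigma_{AB})-H(\sigma_B)$ for the conditional von Neumann entropy, and let $$K(\sigma)=\tfrac12\max\big[H_\sigma(U_1U_2|W_1E_1E_2)-H(P_{W_1})-P_{W_1}(0)H(P_{W_2|W_1=0}),\ H_\sigma(U_2|W_1U_1E_1E_2)-P_{W_1}(0)H(P_{W_2|W_1=0})\big].$$ **(a)** Let $\sigma$ be a two-qubit density operator with Bell-diagonal entries $\langle\psi(\mathsf x,\mathsf z)|\sigma|\psi(\mathsf x,\mathsf z)\rangle=P_{\mathsf{XZ}}(\mathsf x,\mathsf z)$. Then $\hat\sigma$ is the Bell diagonal state $\sum P_{\mathsf{XZ}}(\mathsf x,\mathsf z)|\psi(\mathsf x,\mathsf z)\rangle\langle\psi(\mathsf x,\mathsf z)|$, the distributions $P_{W_1}$ and $P_{W_2|W_1=0}$ are the same for $\hat\sigma$ as for $\sigma$, and, for every choice of the two purifications, $$H_{\hat\sigma}(U_1U_2|W_1E_1E_2)\le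 H_\sigma(U_1U_2|W_1E_1E_2),\qquad H_{\hat\sigma}(U_2|W_1U_1E_1E_2)\le H_\sigma(U_2|W_1U_1E_1E_2),$$ so that $K(\hat\sigma)\le K(\sigma)$. Thus, for fixed Bell-diagonal entries, the Bell diagonal state is the worst case. **(b)** Let $\{M_a\}_{a\in\mathcal A}$ be a POVM on two qubits with finitely many outcomes, let $Q:\mathcal A\to\mathbb R$, and let $\Gamma(Q)$ be the set of two-qubit density operators $\sigma$ with $\mathrm{Tr}[M_a\sigma]=Q(a)$ for all $a$. Suppose that $\Gamma(Q)$ is non-empty and that $\hat\sigma\in\Gamma(Q)$ for every $\sigma\in\Gamma(Q)$ (as is the case whenever membership of a density operator in $\Gamma(Q)$ depends only on its Bell-diagonal entries). Then the minima of $K$ over $\Gamma(Q)$ and over the Bell diagonal states in $\Gamma(Q)$ both exist, and they are equal. **(c)** Let $r_z,r_x,r_y\ge0$ with $r_z+r_x+r_y=1$. Let $|0_b\rangle,|1_b\rangle$ be the standard orthonormal bases for $b\in\{z,x,y\}$, namely $|0\rangle,|1\rangle$; $\frac1{\sqrt2}(|0\rangle\pm|1\rangle)$; $\frac1{\sqrt2}(|0\rangle\pm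 i|1\rangle)$. Consider the operators $$M_{b,d}=r_b\sum_{a\in\mathbb F_2}|a_b\rangle\langle a_b|\otimes|\overline{(a+d)_b}\rangle\langle\overline{(a+d)_b}|,\qquad b\in\{z,x,y\},\ d\in\mathbb F_2,$$ where the bar denotes complex conjugation of the coordinates. They describe the error estimation of the six-state protocol if all $r_b>0$, and of the BB84 protocol if $r_z,r_x>0$ and $r_y=0$. The $M_{b,d}$ form a POVM, and for every $Q$ the set $\Gamma(Q)$ is closed under $\sigma\mapsto\hat\sigma$. Hence, whenever $\Gamma(Q)$ is non-empty, the minimum of $K$ over $\Gamma(Q)$ exists and equals the minimum over the Bell diagonal states in $\Gamma(Q)$. -/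

import Mathlib

open scoped Kronecker Matrix ComplexOrder

noncomputable section

/-! ### Finite-dimensional quantum states -/

/-- The field with two elements. -/
abbrev F2 : Type := ZMod 2

/-- Labels `(x, y)` of the computational basis `|x⟩|y⟩` of the two-qubit space of Alice and Bob;
also the pairs of outcomes when both measure in that basis. -/
abbrev TwoQubit : Type := F2 × F2

/-- A density operator: positive semidefinite of trace one. -/
def IsDensity {n : Type*} [Fintype n] (ρ : Matrix n n ℂ) : Prop :=
  ρ.PosSemidef ∧ ρ.trace = 1

/-- Partial trace over the second tensor factor. -/
def partialTraceRight {n m : Type*} [Fintype m] (ρ : Matrix (n × m) (n × m) ℂ) : Matrix n n ℂ :=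
  Matrix.of fun i j => ∑ k, ρ (i, k) (j, k)

/-- Partial trace over the first tensor factor. -/
def partialTraceLeft {n m : Type*} [Fintype n] (ρ : Matrix (n × m) (n × m) ℂ) : Matrix m m ℂ :=
  Matrix.of fun i j => ∑ k, ρ (k, i) (k, j)

/-- The rank-one operator `|v⟩⟨v|`. -/
def ketbra {n : Type*} (v : n → ℂ) : Matrix n n ℂ :=
  Matrix.vecMulVec v (star v)

/-- `φ`, a vector on the two-qubit system and an environment `E`, purifies `σ`. -/
def IsPurification {E : Type*} [Fintype E] (φ : TwoQubit × E → ℂ)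
    (σ : Matrix TwoQubit TwoQubit ℂ) : Prop :=
  partialTraceRight (ketbra φ) = σ

/-- Von Neumann entropy `-Tr ρ log₂ ρ` (functional calculus of the Hermitian matrix `ρ`). -/
def vonNeumannEntropy {n : Type*} [Fintype n] [DecidableEq n] (ρ : Matrix n n ℂ) : ℝ :=
  ((cfc (fun x : ℝ => -(x * Real.logb 2 x)) ρ).trace).re

/-- Shannon entropy to base two. -/
def shannonEntropy {K : Type*} [Fintype K] (P : K → ℝ) : ℝ :=
  ∑ k, -(P k * Real.logb 2 (P k))

/-! ### Bell states and discrete twirling -/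

/-- The Bell state `ψ(x,z) = (|0⟩|0+x⟩ + (-1)^z |1⟩|1+x⟩)/√2`. -/
def bellState (x z : F2) : TwoQubit → ℂ := fun ab =>
  if ab.2 = ab.1 + x then (-1 : ℂ) ^ (z * ab.1).val / (Real.sqrt 2 : ℂ) else 0

/-- `∑ P(x,z) |ψ(x,z)⟩⟨ψ(x,z)|`. -/
def bellDiagonal (P : F2 × F2 → ℝ) : Matrix TwoQubit TwoQubit ℂ :=
  ∑ x : F2, ∑ z : F2, (P (x, z) : ℂ) • ketbra (bellState x z)

/-- Bell-diagonal states: `bellDiagonal P` for a probability distribution `P`. -/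
def IsBellDiagonal (σ : Matrix TwoQubit TwoQubit ℂ) : Prop :=
  ∃ P : F2 × F2 → ℝ, (∀ k, 0 ≤ P k) ∧ ∑ k, P k = 1 ∧ σ = bellDiagonal P

/-- The bit flip `|a⟩ ↦ |a+1⟩`. -/
def pauliX : Matrix F2 F2 ℂ := Matrix.of fun i j => if i = j + 1 then 1 else 0

/-- The phase flip `|a⟩ ↦ (-1)^a |a⟩`. -/
def pauliZ : Matrix F2 F2 ℂ := Matrix.diagonal fun a => (-1 : ℂ) ^ a.val

/-- The Pauli operator `X^s Z^t`. -/
def pauliXZ (s t : F2) : Matrix F2 F2 ℂ := pauliX ^ s.val * pauliZ ^ t.val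

/-- The discrete twirl. The operators `X^s Z^t ⊗ X^s Z^t` are Hermitian, so that no adjoint
is needed on the right factor. -/
def twirl (σ : Matrix TwoQubit TwoQubit ℂ) : Matrix TwoQubit TwoQubit ℂ :=
  (1 / 4 : ℂ) • ∑ s : F2, ∑ t : F2,
    (pauliXZ s t ⊗ₖ pauliXZ s t) * σ * (pauliXZ s t ⊗ₖ pauliXZ s t)

/-! ### Classical random variables of the reconciliation protocol

An outcome is `o = ((x₁, y₁), (x₂, y₂))`. -/

/-- Outcomes `((x₁, y₁), (x₂, y₂))` of the measurement of two copies. -/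
abbrev Outcome : Type := TwoQubit × TwoQubit

def xi1 (a b : F2) : F2 := a + b

def xi2 (a b : F2) : F2 := if b = 0 then a else 0

def rvU1 (o : Outcome) : F2 := xi1 o.1.1 o.2.1

def rvV1 (o : Outcome) : F2 := xi1 o.1.2 o.2.2

def rvW1 (o : Outcome) : F2 := rvU1 o + rvV1 o

def rvU2 (o : Outcome) : F2 := xi2 o.2.1 (rvW1 o)

def rvV2 (o : Outcome) : F2 := xi2 o.2.2 (rvW1 o)

def rvW2 (o : Outcome) : F2 := rvU2 o + rvV2 o

/-- The projector `|x⟩⟨x|` of the measurement in the computational basis. -/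
def zProj (x : F2) : Matrix F2 F2 ℂ := Matrix.single x x 1

/-- The distribution `P_XY(x,y) = Tr[(M_x ⊗ M_y) σ]` of the raw bits. -/
def distXY (σ : Matrix TwoQubit TwoQubit ℂ) (o : TwoQubit) : ℝ :=
  ((zProj o.1 ⊗ₖ zProj o.2) * σ).trace.re

/-- The distribution of `((X₁, Y₁), (X₂, Y₂))`, two independent copies of `P_XY`. -/
def distOutcome (σ : Matrix TwoQubit TwoQubit ℂ) (o : Outcome) : ℝ :=
  distXY σ o.1 * distXY σ o.2

/-- The distribution of `W₁`. -/
def distW1 (σ : Matrix TwoQubit TwoQubit ℂ) (w : F2) : ℝ :=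
  ∑ o : Outcome with rvW1 o = w, distOutcome σ o

/-- The conditional distribution of `W₂` given `W₁ = 0`. -/
def distW2GivenW1Zero (σ : Matrix TwoQubit TwoQubit ℂ) (w : F2) : ℝ :=
  (∑ o : Outcome with rvW1 o = 0 ∧ rvW2 o = w, distOutcome σ o) / distW1 σ 0

/-! ### Classical-quantum states and the key-rate formula

A state that is classical on a register `K` is given by the family of its unnormalized
conditional operators `τ k`; as an operator it is `∑ k, |k⟩⟨k| ⊗ τ k`, that is, the block
diagonal matrix with the blocks `τ k`. -/

/-- The unnormalized state of `E` after the outcome `(x, y)` of the measurement of the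
two qubits of `ρ` in the computational basis: `Tr_AB[(M_x ⊗ M_y ⊗ 1) ρ]`. -/
def measuredState {E : Type*} [Fintype E] [DecidableEq E]
    (ρ : Matrix (TwoQubit × E) (TwoQubit × E) ℂ) (o : TwoQubit) : Matrix E E ℂ :=
  partialTraceLeft (((zProj o.1 ⊗ₖ zProj o.2) ⊗ₖ (1 : Matrix E E ℂ)) * ρ)

/-- The state of `X₁ X₂ Y₁ Y₂ E₁ E₂` obtained by measuring two copies of the pure state `φ`. -/
def measuredPair {E : Type*} [Fintype E] [DecidableEq E]
    (φ : TwoQubit × E → ℂ) (o : Outcome) : Matrix (E × E) (E × E) ℂ :=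
  measuredState (ketbra φ) o.1 ⊗ₖ measuredState (ketbra φ) o.2

/-- The state of `(g(O), E)`, from the state `τ` of `(O, E)`. -/
def pushClassical {Ω K m : Type*} [Fintype Ω] [DecidableEq K] (g : Ω → K)
    (τ : Ω → Matrix m m ℂ) : K → Matrix m m ℂ :=
  fun k => ∑ o : Ω with g o = k, τ o

/-- `H(f(O) | g(O) E) = H(f(O) g(O) E) - H(g(O) E)` for the state `τ` of `(O, E)`. -/
def condEntropy {Ω A B m : Type*} [Fintype Ω] [Fintype A] [DecidableEq A] [Fintype B]
    [DecidableEq B] [Fintype m] [DecidableEq m] (f : Ω → A) (g : Ω → B)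
    (τ : Ω → Matrix m m ℂ) : ℝ :=
  vonNeumannEntropy (Matrix.blockDiagonal (pushClassical (fun o => (f o, g o)) τ))
    - vonNeumannEntropy (Matrix.blockDiagonal (pushClassical g τ))

/-- `H(U₁U₂ | W₁E₁E₂)`. -/
def entropyU1U2 {E : Type*} [Fintype E] [DecidableEq E] (φ : TwoQubit × E → ℂ) : ℝ :=
  condEntropy (fun o => (rvU1 o, rvU2 o)) rvW1 (measuredPair φ)

/-- `H(U₂ | W₁U₁E₁E₂)`. -/
def entropyU2 {E : Type*} [Fintype E] [DecidableEq E] (φ : TwoQubit × E → ℂ) : ℝ :=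
  condEntropy rvU2 (fun o => (rvW1 o, rvU1 o)) (measuredPair φ)

/-- The quantity minimized in the key-rate formula, for the two-qubit state `σ` with the
purification `φ`. -/
def keyRate {E : Type*} [Fintype E] [DecidableEq E] (σ : Matrix TwoQubit TwoQubit ℂ)
    (φ : TwoQubit × E → ℂ) : ℝ :=
  1 / 2 * max
    (entropyU1U2 φ - shannonEntropy (distW1 σ)
      - distW1 σ 0 * shannonEntropy (distW2GivenW1Zero σ))
    (entropyU2 φ - distW1 σ 0 * shannonEntropy (distW2GivenW1Zero σ))

/-- The values of the key-rate formula at the states in `S` (and their purifications). -/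
def keyRateValues (S : Set (Matrix TwoQubit TwoQubit ℂ)) : Set ℝ :=
  {r | ∃ σ ∈ S, ∃ (d : ℕ) (φ : TwoQubit × Fin d → ℂ), IsPurification φ σ ∧ r = keyRate σ φ}

/-! ### Parameter estimation -/

/-- A positive operator valued measurement on two qubits. -/
def IsPOVM {𝒜 : Type*} [Fintype 𝒜] (M : 𝒜 → Matrix TwoQubit TwoQubit ℂ) : Prop :=
  (∀ a, (M a).PosSemidef) ∧ ∑ a, M a = 1

/-- `Γ(Q)`: the two-qubit density operators whose outcome distribution under `M` is `Q`. -/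
def compatibleStates {𝒜 : Type*} (M : 𝒜 → Matrix TwoQubit TwoQubit ℂ) (Q : 𝒜 → ℝ) :
    Set (Matrix TwoQubit TwoQubit ℂ) :=
  {σ | IsDensity σ ∧ ∀ a, (M a * σ).trace = (Q a : ℂ)}

/-- The three bases of the six-state protocol: `0` is the `z`-basis `|0⟩, |1⟩`, `1` is the
`x`-basis `(|0⟩ ± |1⟩)/√2`, and `2` is the `y`-basis `(|0⟩ ± i|1⟩)/√2`. -/
def qubitBasis (b : Fin 3) (a : F2) : F2 → ℂ := fun j =>
  match b with
  | 0 => if j = a then 1 else 0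
  | 1 => (-1 : ℂ) ^ (a * j).val / (Real.sqrt 2 : ℂ)
  | 2 => (-1 : ℂ) ^ (a * j).val * Complex.I ^ j.val / (Real.sqrt 2 : ℂ)

/-- Error estimation: the basis `b` is used with probability `r b`, and the outcome is `b`
together with `d = 0` (no error) or `d = 1` (error). Bob's outcomes are labelled through the
complex conjugate basis, which only exchanges his two outcomes in the `y`-basis, so that the
state `ψ(0,0)` has no errors. The six-state protocol is the case where all `r b` are positive,
and BB84 the case where `r 0`, `r 1` are positive and `r 2 = 0`. -/
def errorPOVM (r : Fin 3 → ℝ) : Fin 3 × F2 → Matrix TwoQubit TwoQubit ℂ := fun bd =>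
  (r bd.1 : ℂ) • ∑ a : F2,
    ketbra (qubitBasis bd.1 a) ⊗ₖ ketbra (star (qubitBasis bd.1 (a + bd.2)))

end

/-!
Measuring both qubits of a pure state leaves pure conditional states of the environment, so by
duality the entropy of the environment together with a classical function `g` of the outcomes equals
the entropy of the pinching of `σ ⊗ σ` along the level sets of `g`
(`condEntropy_measuredPair`). The conditional entropies in the key-rate formula are therefore
differences `S(P_f ρ) - S(P_g ρ)` of entropies of two pinchings of `ρ = σ ⊗ σ`, the first finer than
the second. In particular they depend on `σ` only, and continuously.

Such a difference is the relative entropy `D(P_g ρ ‖ P_f ρ)`, hence convex in `ρ`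
(`vonNeumannEntropy_pinch_sub_sum_le`) by the joint convexity of relative entropy
(`relativeEntropy_sum_le`). For the latter, `D(ρ ‖ σ)` is an integral over `t` of the forms
`⟨ρ, (L_σ + t R_ρ)⁻¹ ρ⟩`, each of which is a supremum of functions affine in `(ρ, σ)`; instead of an
integral, the proof compares an antiderivative in `t` with its derivative and lets `t → ∞`.

The twirled pair `twirl σ ⊗ twirl σ` is an average of conjugates of `σ ⊗ σ` by signed permutations
which permute the level sets of the classical variables, so all terms of the average have the same
conditional entropies, and convexity shows that twirling does not increase these entropies
(`pinchingGap_twirl_le`). The twirl is the Bell-diagonal part of `σ`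
(`twirl_eq_bellDiagonal`), and the distributions of `W₁` and `W₂` depend only on the distribution of
the parity `X + Y`, which it preserves.

The minimum over `Γ(Q)` is attained by compactness and continuity, and the twirl of a minimizer is a
Bell-diagonal minimizer. The error-estimation operators are fixed by the twirl, which is
self-adjoint for the trace pairing, so `Γ(Q)` is closed under twirling.
-/

noncomputable section

/-! ### Entropy and functional calculus of Hermitian matrices -/

lemma continuous_neg_mul_logb : Continuous fun x : ℝ => -(x * Real.logb 2 x) := by
  have h : (fun x : ℝ => -(x * Real.logb 2 x)) = fun x => -(x * Real.log x / Real.log 2) := by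
    funext x
    rw [Real.logb, mul_div_assoc]
  rw [h]
  exact (Real.continuous_mul_log.div_const _).neg

open scoped Matrix.Norms.L2Operator in
lemma continuousOn_vonNeumannEntropy {n : Type*} [Fintype n] [DecidableEq n] :
    ContinuousOn (vonNeumannEntropy (n := n)) {ρ | ρ.IsHermitian} := by
  have h : ContinuousOn (fun ρ : Matrix n n ℂ => cfc (fun x : ℝ => -(x * Real.logb 2 x)) ρ)
      {ρ | ρ.IsHermitian} :=
    ContinuousOn.cfc_of_mem_nhdsSet (s := Set.univ) _ Filter.univ_mem continuousOn_id
      (fun x hx => hx) continuous_neg_mul_logb.continuousOn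
  exact Complex.continuous_re.comp_continuousOn
    ((Continuous.matrix_trace continuous_id).comp_continuousOn h)

lemma Matrix.trace_aeval_mul_comm {m n : Type*} [Fintype m] [DecidableEq m] [Fintype n]
    [DecidableEq n] (A : Matrix m n ℂ) (B : Matrix n m ℂ) (p : Polynomial ℝ)
    (hp : p.coeff 0 = 0) :
    (Polynomial.aeval (A * B) p).trace = (Polynomial.aeval (B * A) p).trace := by
  have key : ∀ k : ℕ, (A * B) ^ (k + 1) = A * (B * A) ^ k * B := by
    intro k
    induction k with
    | zero => simp
    | succ k ih => rw [pow_succ, ih, pow_succ (B * A)]; simp only [Matrix.mul_assoc]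
  have hk : ∀ k : ℕ, ((A * B) ^ (k + 1)).trace = ((B * A) ^ (k + 1)).trace := by
    intro k
    rw [key, Matrix.trace_mul_comm, ← Matrix.mul_assoc, ← pow_succ']
  rw [Polynomial.aeval_eq_sum_range, Polynomial.aeval_eq_sum_range, Matrix.trace_sum,
    Matrix.trace_sum]
  refine Finset.sum_congr rfl fun i _ => ?_
  rcases i with _ | i
  · simp [hp]
  · rw [Matrix.trace_smul, Matrix.trace_smul, hk]

/-- The nonzero spectra of `A * B` and `B * A` agree with multiplicities, in the form of traces of
functional calculi: on the finite union of both spectra and `{0}`, `f` is a polynomial without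
constant term. -/
lemma Matrix.trace_cfc_mul_comm {m n : Type*} [Fintype m] [DecidableEq m] [Fintype n]
    [DecidableEq n] (A : Matrix m n ℂ) (B : Matrix n m ℂ) (hAB : (A * B).IsHermitian)
    (hBA : (B * A).IsHermitian) (f : ℝ → ℝ) (hf : f 0 = 0) :
    (cfc f (A * B)).trace = (cfc f (B * A)).trace := by
  classical
  let s : Finset ℝ := insert 0 (Matrix.finite_real_spectrum (A := A * B)).toFinset ∪
    (Matrix.finite_real_spectrum (A := B * A)).toFinset
  let p : Polynomial ℝ := Lagrange.interpolate s id f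
  have hp : ∀ x ∈ s, p.eval x = f x := fun x hx =>
    Lagrange.eval_interpolate_at_node f (Set.injOn_id _) hx
  have h0 : p.coeff 0 = 0 := by
    rw [Polynomial.coeff_zero_eq_eval_zero, hp 0 (by simp [s]), hf]
  have e1 : cfc f (A * B) = Polynomial.aeval (A * B) p := by
    rw [← cfc_polynomial p (A * B) hAB]
    refine cfc_congr fun x hx => (hp x ?_).symm
    simp [s, hx]
  have e2 : cfc f (B * A) = Polynomial.aeval (B * A) p := by
    rw [← cfc_polynomial p (B * A) hBA]
    refine cfc_congr fun x hx => (hp x ?_).symm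
    simp [s, hx]
  rw [e1, e2, Matrix.trace_aeval_mul_comm A B p h0]

lemma vonNeumannEntropy_mul_comm {m n : Type*} [Fintype m] [DecidableEq m] [Fintype n]
    [DecidableEq n] (A : Matrix m n ℂ) (B : Matrix n m ℂ) (hAB : (A * B).IsHermitian)
    (hBA : (B * A).IsHermitian) : vonNeumannEntropy (A * B) = vonNeumannEntropy (B * A) := by
  rw [vonNeumannEntropy, vonNeumannEntropy, Matrix.trace_cfc_mul_comm A B hAB hBA _ (by simp)]

lemma vonNeumannEntropy_eq_neg_trace_mul_log {n : Type*} [Fintype n] [DecidableEq n]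
    {ρ : Matrix n n ℂ} (hρ : ρ.IsHermitian) :
    vonNeumannEntropy ρ = -(ρ * cfc Real.log ρ).trace.re / Real.log 2 := by
  have hc : ∀ f : ℝ → ℝ, ContinuousOn f (spectrum ℝ ρ) := fun f =>
    (Matrix.finite_real_spectrum (A := ρ)).continuousOn f
  have h1 : ρ * cfc Real.log ρ = cfc (fun x : ℝ => x * Real.log x) ρ := by
    rw [cfc_mul (fun x : ℝ => x) Real.log ρ (hc _) (hc _), cfc_id' ℝ ρ hρ.isSelfAdjoint]
  have h2 : cfc (fun x : ℝ => -(x * Real.logb 2 x)) ρ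
      = (-(Real.log 2)⁻¹) • cfc (fun x : ℝ => x * Real.log x) ρ := by
    rw [← cfc_smul _ _ _ (hc _)]
    refine cfc_congr fun x _ => ?_
    simp only [Real.logb, smul_eq_mul]
    ring
  rw [vonNeumannEntropy, h2, h1, Matrix.trace_smul, Complex.smul_re, smul_eq_mul]
  ring

/-! ### Joint convexity of the relative entropy -/

/-- The concave quadratic form in `Y` whose supremum is the resolvent form
`⟨ρ, (L_σ + t R_ρ)⁻¹ ρ⟩`, with `L` and `R` left and right multiplication. It is affine in the
pair `(ρ, σ)`. -/
def resolventQuadratic {n : Type*} [Fintype n] (t : ℝ) (ρ σ Y : Matrix n n ℂ) : ℝ :=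
  2 * (Yᴴ * ρ).trace.re - (Yᴴ * σ * Y).trace.re - t * (Y * ρ * Yᴴ).trace.re

lemma resolventQuadratic_sum {n ι : Type*} [Fintype n] (s : Finset ι) (w : ι → ℝ)
    (ρ σ : ι → Matrix n n ℂ) (t : ℝ) (Y : Matrix n n ℂ) :
    resolventQuadratic t (∑ k ∈ s, w k • ρ k) (∑ k ∈ s, w k • σ k) Y
      = ∑ k ∈ s, w k * resolventQuadratic t (ρ k) (σ k) Y := by
  simp only [resolventQuadratic, Matrix.sum_mul, Matrix.trace_sum,
    Matrix.mul_smul, Matrix.smul_mul, Matrix.trace_smul, Complex.re_sum, Complex.smul_re,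
    smul_eq_mul, Finset.mul_sum, ← Finset.sum_sub_distrib]
  exact Finset.sum_congr rfl fun k _ => by ring

section EigenbasisCalculus

variable {n : Type*} [Fintype n] [DecidableEq n]

/-- The transition probabilities `|⟨vⱼ, uᵢ⟩|²` from the eigenbasis `u` of `ρ` to the eigenbasis `v`
of `σ`. -/
def eigenOverlap {ρ σ : Matrix n n ℂ} (hρ : ρ.IsHermitian) (hσ : σ.IsHermitian) (j i : n) : ℝ :=
  Complex.normSq ((star (hσ.eigenvectorUnitary : Matrix n n ℂ) * hρ.eigenvectorUnitary) j i)

lemma Matrix.IsHermitian.cfc_eq_mul_diagonal {ρ : Matrix n n ℂ} (hρ : ρ.IsHermitian) (f : ℝ → ℝ) :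
    cfc f ρ = (hρ.eigenvectorUnitary : Matrix n n ℂ) *
      Matrix.diagonal (fun i => (f (hρ.eigenvalues i) : ℂ)) *
        star (hρ.eigenvectorUnitary : Matrix n n ℂ) := by
  rw [hρ.cfc_eq, Matrix.IsHermitian.cfc, Unitary.conjStarAlgAut_apply]
  rfl

lemma Matrix.IsHermitian.eq_mul_diagonal {ρ : Matrix n n ℂ} (hρ : ρ.IsHermitian) :
    ρ = (hρ.eigenvectorUnitary : Matrix n n ℂ) *
      Matrix.diagonal (fun i => (hρ.eigenvalues i : ℂ)) *
        star (hρ.eigenvectorUnitary : Matrix n n ℂ) := by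
  conv_lhs => rw [← cfc_id' ℝ ρ hρ.isSelfAdjoint, hρ.cfc_eq_mul_diagonal]

lemma trace_cfc_mul_cfc {ρ σ : Matrix n n ℂ} (hρ : ρ.IsHermitian) (hσ : σ.IsHermitian)
    (f g : ℝ → ℝ) :
    (cfc f ρ * cfc g σ).trace.re =
      ∑ j, ∑ i, eigenOverlap hρ hσ j i * (f (hρ.eigenvalues i) * g (hσ.eigenvalues j)) := by
  rw [hρ.cfc_eq_mul_diagonal, hσ.cfc_eq_mul_diagonal]
  simp only [eigenOverlap]
  set U := (hρ.eigenvectorUnitary : Matrix n n ℂ)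
  set V := (hσ.eigenvectorUnitary : Matrix n n ℂ)
  set M := star V * U with hM
  set D := Matrix.diagonal fun i => (f (hρ.eigenvalues i) : ℂ) with hD
  set E := Matrix.diagonal fun i => (g (hσ.eigenvalues i) : ℂ) with hE
  have hMs : star M = star U * V := by rw [hM, star_mul, star_star]
  have h1 : (U * D * star U * (V * E * star V)).trace = (M * (D * (star M * E))).trace := by
    rw [hMs, hM, ← Matrix.mul_assoc (U * D * star U), Matrix.trace_mul_comm]
    simp only [Matrix.mul_assoc]
  rw [h1, Matrix.trace, Complex.re_sum]
  refine Finset.sum_congr rfl fun j _ => ?_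
  rw [Matrix.diag_apply, Matrix.mul_apply, Complex.re_sum]
  refine Finset.sum_congr rfl fun i _ => ?_
  rw [hD, hE, Matrix.diagonal_mul, Matrix.mul_diagonal, Matrix.star_apply]
  have : M j i * (↑(f (hρ.eigenvalues i)) * (star (M j i) * ↑(g (hσ.eigenvalues j))))
      = ((Complex.normSq (M j i) * (f (hρ.eigenvalues i) * g (hσ.eigenvalues j)) : ℝ) : ℂ) := by
    push_cast
    rw [← Complex.mul_conj]
    simp only [Complex.star_def]
    ring
  rw [this, Complex.ofReal_re]

/-- The resolvent form `⟨ρ, (L_σ + t R_ρ)⁻¹ ρ⟩`, evaluated in eigenbases of `ρ` and `σ`. -/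
def resolventForm {ρ σ : Matrix n n ℂ} (hρ : ρ.IsHermitian) (hσ : σ.IsHermitian) (t : ℝ) : ℝ :=
  ∑ j, ∑ i, eigenOverlap hρ hσ j i *
    (hρ.eigenvalues i ^ 2 / (hσ.eigenvalues j + t * hρ.eigenvalues i))

lemma resolventQuadratic_eigenbasis {ρ σ : Matrix n n ℂ} (hρ : ρ.IsHermitian)
    (hσ : σ.IsHermitian) (t : ℝ) (y : Matrix n n ℂ) :
    resolventQuadratic t ρ σ (hσ.eigenvectorUnitary * y * star (hρ.eigenvectorUnitary :
      Matrix n n ℂ)) = ∑ j, ∑ i, (2 * (star (y j i) * (star (hσ.eigenvectorUnitary :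
        Matrix n n ℂ) * hρ.eigenvectorUnitary) j i).re * hρ.eigenvalues i
        - Complex.normSq (y j i) * (hσ.eigenvalues j + t * hρ.eigenvalues i)) := by
  have hUU : star (hρ.eigenvectorUnitary : Matrix n n ℂ) * hρ.eigenvectorUnitary = 1 :=
    Unitary.coe_star_mul_self _
  have hVV : star (hσ.eigenvectorUnitary : Matrix n n ℂ) * hσ.eigenvectorUnitary = 1 :=
    Unitary.coe_star_mul_self _
  have eρ := hρ.eq_mul_diagonal
  have eσ := hσ.eq_mul_diagonal
  generalize hρ.eigenvalues = p at *
  generalize hσ.eigenvalues = q at *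
  generalize (hρ.eigenvectorUnitary : Matrix n n ℂ) = U at *
  generalize (hσ.eigenvectorUnitary : Matrix n n ℂ) = V at *
  clear hρ hσ
  subst eρ eσ
  set D := Matrix.diagonal fun i => (p i : ℂ) with hD
  set E := Matrix.diagonal fun i => (q i : ℂ) with hE
  set M := star V * U with hM
  have hstar : (V * y * star U)ᴴ = U * (yᴴ * star V) := by
    simp [Matrix.conjTranspose_mul, Matrix.star_eq_conjTranspose]
  have cU : ∀ Z : Matrix n n ℂ, star U * (U * Z) = Z := fun Z => by
    rw [← Matrix.mul_assoc, hUU, Matrix.one_mul]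
  have cV : ∀ Z : Matrix n n ℂ, star V * (V * Z) = Z := fun Z => by
    rw [← Matrix.mul_assoc, hVV, Matrix.one_mul]
  have t1 : ((V * y * star U)ᴴ * (U * D * star U)).trace = (yᴴ * (M * D)).trace := by
    rw [hstar, ← Matrix.mul_assoc, Matrix.trace_mul_comm, hM]
    simp only [Matrix.mul_assoc, cU]
  have t2 : ((V * y * star U)ᴴ * (V * E * star V) * (V * y * star U)).trace
      = (yᴴ * (E * y)).trace := by
    rw [hstar, ← Matrix.mul_assoc, Matrix.trace_mul_comm]
    simp only [Matrix.mul_assoc, cU, cV]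
  have t3 : ((V * y * star U) * (U * D * star U) * (V * y * star U)ᴴ).trace
      = (y * D * yᴴ).trace := by
    rw [hstar]
    simp only [Matrix.mul_assoc, cU]
    rw [Matrix.trace_mul_comm]
    simp only [Matrix.mul_assoc, hVV, Matrix.mul_one]
  rw [resolventQuadratic, t1, t2, t3, Matrix.trace_mul_comm yᴴ, Matrix.trace_mul_comm yᴴ]
  simp only [Matrix.trace, Complex.re_sum, Matrix.diag_apply, Matrix.mul_apply (N := yᴴ),
    Finset.mul_sum]
  simp only [← Finset.sum_sub_distrib]
  refine Finset.sum_congr rfl fun j _ => Finset.sum_congr rfl fun i _ => ?_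
  rw [hD, hE, Matrix.mul_diagonal, Matrix.diagonal_mul, Matrix.mul_diagonal,
    Matrix.conjTranspose_apply]
  generalize y j i = z
  generalize M j i = w
  simp only [Complex.star_def, Complex.mul_re, Complex.mul_im, Complex.conj_re, Complex.conj_im,
    Complex.ofReal_re, Complex.ofReal_im, Complex.normSq_apply]
  ring

lemma two_mul_re_sub_normSq_le (z w : ℂ) (p s : ℝ) (hs : 0 < s) :
    2 * (star z * w).re * p - Complex.normSq z * s ≤ Complex.normSq w * (p ^ 2 / s) := by
  have h : Complex.normSq w * (p ^ 2 / s) - (2 * (star z * w).re * p - Complex.normSq z * s)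
      = ((w.re * p - z.re * s) ^ 2 + (w.im * p - z.im * s) ^ 2) / s := by
    simp only [Complex.star_def, Complex.mul_re, Complex.conj_re, Complex.conj_im,
      Complex.normSq_apply]
    field_simp
    ring
  have : 0 ≤ ((w.re * p - z.re * s) ^ 2 + (w.im * p - z.im * s) ^ 2) / s := by positivity
  linarith

lemma resolventQuadratic_le {ρ σ : Matrix n n ℂ} (hρ : ρ.PosSemidef) (hσ : σ.PosDef) {t : ℝ}
    (ht : 0 ≤ t) (Y : Matrix n n ℂ) :
    resolventQuadratic t ρ σ Y ≤ resolventForm hρ.1 hσ.1 t := by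
  have hY : Y = (hσ.1.eigenvectorUnitary : Matrix n n ℂ) *
      (star (hσ.1.eigenvectorUnitary : Matrix n n ℂ) * Y * hρ.1.eigenvectorUnitary) *
        star (hρ.1.eigenvectorUnitary : Matrix n n ℂ) := by
    have h1 : (hσ.1.eigenvectorUnitary : Matrix n n ℂ) *
      star (hσ.1.eigenvectorUnitary : Matrix n n ℂ) = 1 := Unitary.coe_mul_star_self _
    have h2 : (hρ.1.eigenvectorUnitary : Matrix n n ℂ) *
      star (hρ.1.eigenvectorUnitary : Matrix n n ℂ) = 1 := Unitary.coe_mul_star_self _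
    simp only [← Matrix.mul_assoc, h1, Matrix.one_mul]
    rw [Matrix.mul_assoc, h2, Matrix.mul_one]
  rw [hY, resolventQuadratic_eigenbasis]
  refine Finset.sum_le_sum fun j _ => Finset.sum_le_sum fun i _ => ?_
  exact two_mul_re_sub_normSq_le _ _ _ _
    (add_pos_of_pos_of_nonneg (hσ.eigenvalues_pos j) (mul_nonneg ht (hρ.eigenvalues_nonneg i)))

lemma exists_resolventQuadratic_eq {ρ σ : Matrix n n ℂ} (hρ : ρ.PosSemidef) (hσ : σ.PosDef)
    {t : ℝ} (ht : 0 ≤ t) :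
    ∃ Y, resolventQuadratic t ρ σ Y = resolventForm hρ.1 hσ.1 t := by
  -- In the eigenbases, the maximizer solves `σ Y + t Y ρ = ρ` entry by entry.
  refine ⟨_, (resolventQuadratic_eigenbasis hρ.1 hσ.1 t (Matrix.of fun j i =>
    (star (hσ.1.eigenvectorUnitary : Matrix n n ℂ) * hρ.1.eigenvectorUnitary) j i *
      ((hρ.1.eigenvalues i / (hσ.1.eigenvalues j + t * hρ.1.eigenvalues i) : ℝ) : ℂ))).trans ?_⟩
  refine Finset.sum_congr rfl fun j _ => Finset.sum_congr rfl fun i _ => ?_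
  have hs : 0 < hσ.1.eigenvalues j + t * hρ.1.eigenvalues i :=
    add_pos_of_pos_of_nonneg (hσ.eigenvalues_pos j) (mul_nonneg ht (hρ.eigenvalues_nonneg i))
  rw [eigenOverlap, Matrix.of_apply]
  generalize (star (hσ.1.eigenvectorUnitary : Matrix n n ℂ) * hρ.1.eigenvectorUnitary) j i = w
  generalize hσ.1.eigenvalues j + t * hρ.1.eigenvalues i = s at *
  simp only [Complex.star_def, Complex.mul_re, Complex.mul_im, Complex.conj_re, Complex.conj_im,
    Complex.normSq_apply, Complex.ofReal_re, Complex.ofReal_im]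
  field_simp
  ring

/-- Joint convexity of the resolvent form, as a supremum of affine functions of `(ρ, σ)`. -/
lemma resolventForm_sum_le {ι : Type*} (s : Finset ι) (w : ι → ℝ) (hw : ∀ k ∈ s, 0 ≤ w k)
    {ρ σ : ι → Matrix n n ℂ} (hρ : ∀ k, (ρ k).PosSemidef) (hσ : ∀ k, (σ k).PosDef)
    (hρs : (∑ k ∈ s, w k • ρ k).PosSemidef) (hσs : (∑ k ∈ s, w k • σ k).PosDef)
    {t : ℝ} (ht : 0 ≤ t) :
    resolventForm hρs.1 hσs.1 t ≤ ∑ k ∈ s, w k * resolventForm (hρ k).1 (hσ k).1 t := by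
  obtain ⟨Y, hY⟩ := exists_resolventQuadratic_eq hρs hσs ht
  rw [← hY, resolventQuadratic_sum]
  exact Finset.sum_le_sum fun k hk =>
    mul_le_mul_of_nonneg_left (resolventQuadratic_le (hρ k) (hσ k) ht Y) (hw k hk)

/-- The sum `∑ |⟨vⱼ, uᵢ⟩|² pᵢ log (qⱼ + t pᵢ)` over the eigenvalues `p` of `ρ` and `q` of `σ`, an
antiderivative of the resolvent form. -/
def logForm {ρ σ : Matrix n n ℂ} (hρ : ρ.IsHermitian) (hσ : σ.IsHermitian) (t : ℝ) : ℝ :=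
  ∑ j, ∑ i, eigenOverlap hρ hσ j i *
    (hρ.eigenvalues i * Real.log (hσ.eigenvalues j + t * hρ.eigenvalues i))

lemma hasDerivAt_logForm {ρ σ : Matrix n n ℂ} (hρ : ρ.PosSemidef) (hσ : σ.PosDef) {t : ℝ}
    (ht : 0 ≤ t) : HasDerivAt (logForm hρ.1 hσ.1) (resolventForm hρ.1 hσ.1 t) t := by
  unfold logForm resolventForm
  refine HasDerivAt.fun_sum fun j _ => HasDerivAt.fun_sum fun i _ => ?_
  have hs : 0 < hσ.1.eigenvalues j + t * hρ.1.eigenvalues i :=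
    add_pos_of_pos_of_nonneg (hσ.eigenvalues_pos j) (mul_nonneg ht (hρ.eigenvalues_nonneg i))
  have h := (((hasDerivAt_id t).mul_const (hρ.1.eigenvalues i)).const_add
    (hσ.1.eigenvalues j)).log hs.ne'
  refine ((h.const_mul (hρ.1.eigenvalues i)).const_mul
    (eigenOverlap hρ.1 hσ.1 j i)).congr_deriv ?_
  simp only [id]
  ring

lemma logForm_sub_sum_le {ι : Type*} (s : Finset ι) (w : ι → ℝ) (hw : ∀ k ∈ s, 0 ≤ w k)
    {ρ σ : ι → Matrix n n ℂ} (hρ : ∀ k, (ρ k).PosSemidef) (hσ : ∀ k, (σ k).PosDef)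
    (hρs : (∑ k ∈ s, w k • ρ k).PosSemidef) (hσs : (∑ k ∈ s, w k • σ k).PosDef)
    {t : ℝ} (ht : 0 ≤ t) :
    logForm hρs.1 hσs.1 t - logForm hρs.1 hσs.1 0
      ≤ ∑ k ∈ s, w k * (logForm (hρ k).1 (hσ k).1 t - logForm (hρ k).1 (hσ k).1 0) := by
  have hd : ∀ u, 0 ≤ u → HasDerivAt (fun u => ∑ k ∈ s, w k * logForm (hρ k).1 (hσ k).1 u
      - logForm hρs.1 hσs.1 u) (∑ k ∈ s, w k * resolventForm (hρ k).1 (hσ k).1 u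
      - resolventForm hρs.1 hσs.1 u) u := fun u hu =>
    (HasDerivAt.fun_sum fun k _ => (hasDerivAt_logForm (hρ k) (hσ k) hu).const_mul (w k)).sub
      (hasDerivAt_logForm hρs hσs hu)
  have hmono : MonotoneOn (fun u => ∑ k ∈ s, w k * logForm (hρ k).1 (hσ k).1 u
      - logForm hρs.1 hσs.1 u) (Set.Ici 0) := by
    refine monotoneOn_of_deriv_nonneg (convex_Ici 0)
      (fun u hu => (hd u hu).continuousAt.continuousWithinAt)
      (fun u hu => (hd u (interior_subset hu)).differentiableAt.differentiableWithinAt)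
      fun u hu => ?_
    have hu : 0 ≤ u := interior_subset hu
    rw [(hd u hu).deriv, sub_nonneg]
    exact resolventForm_sum_le s w hw hρ hσ hρs hσs hu
  have := hmono (Set.self_mem_Ici) (Set.mem_Ici.mpr ht) ht
  simp only [mul_sub, Finset.sum_sub_distrib] at this ⊢
  linarith

lemma trace_re_eq_sum_eigenOverlap {ρ σ : Matrix n n ℂ} (hρ : ρ.IsHermitian)
    (hσ : σ.IsHermitian) :
    ρ.trace.re = ∑ j, ∑ i, eigenOverlap hρ hσ j i * hρ.eigenvalues i := by
  have h := trace_cfc_mul_cfc hρ hσ (fun x => x) (fun _ => 1)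
  rw [cfc_id' ℝ ρ hρ.isSelfAdjoint, cfc_const_one ℝ σ hσ.isSelfAdjoint, Matrix.mul_one] at h
  simpa using h

/-- As `t → ∞`, `log (qⱼ + t pᵢ) - log t` tends to `log pᵢ`; terms with `pᵢ = 0` vanish. -/
lemma tendsto_logForm {ρ σ : Matrix n n ℂ} (hρ : ρ.PosSemidef) (hσ : σ.PosDef) :
    Filter.Tendsto (fun t => logForm hρ.1 hσ.1 t - Real.log t * ρ.trace.re) Filter.atTop
      (nhds (ρ * cfc Real.log ρ).trace.re) := by
  have hc : ∀ f : ℝ → ℝ, ContinuousOn f (spectrum ℝ ρ) := fun f =>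
    (Matrix.finite_real_spectrum (A := ρ)).continuousOn f
  have h1 : (ρ * cfc Real.log ρ).trace.re = ∑ j, ∑ i, eigenOverlap hρ.1 hσ.1 j i *
      (hρ.1.eigenvalues i * Real.log (hρ.1.eigenvalues i)) := by
    have h := trace_cfc_mul_cfc hρ.1 hσ.1 (fun x => x * Real.log x) (fun _ => 1)
    rw [cfc_mul (fun x : ℝ => x) Real.log ρ (hc _) (hc _), cfc_id' ℝ ρ hρ.1.isSelfAdjoint,
      cfc_const_one ℝ σ hσ.1.isSelfAdjoint, Matrix.mul_one] at h
    simpa using h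
  rw [h1]
  simp only [logForm, trace_re_eq_sum_eigenOverlap hρ.1 hσ.1, Finset.mul_sum,
    ← Finset.sum_sub_distrib]
  refine tendsto_finsetSum _ fun j _ => tendsto_finsetSum _ fun i _ => ?_
  rcases (hρ.eigenvalues_nonneg i).eq_or_lt with h0 | hp
  · simp [← h0]
  have hq := hσ.eigenvalues_pos j
  generalize hρ.1.eigenvalues i = p at *
  generalize hσ.1.eigenvalues j = q at *
  generalize eigenOverlap hρ.1 hσ.1 j i = c
  have hlim : Filter.Tendsto (fun t : ℝ => q * t⁻¹ + p) Filter.atTop (nhds p) := by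
    simpa using (tendsto_inv_atTop_zero.const_mul q).add_const p
  refine (((hlim.log hp.ne').const_mul p).const_mul c).congr' ?_
  filter_upwards [Filter.eventually_gt_atTop (0 : ℝ)] with t ht
  have : q + t * p = t * (q * t⁻¹ + p) := by field_simp
  rw [this, Real.log_mul ht.ne' (by positivity)]
  ring

/-- Quantum relative entropy `Tr ρ (log ρ - log σ)`, in natural units and for positive
definite `σ`. -/
def relativeEntropy (ρ σ : Matrix n n ℂ) : ℝ :=
  (ρ * cfc Real.log ρ).trace.re - (ρ * cfc Real.log σ).trace.re

lemma tendsto_logForm_sub {ρ σ : Matrix n n ℂ} (hρ : ρ.PosSemidef) (hσ : σ.PosDef) :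
    Filter.Tendsto (fun t => logForm hρ.1 hσ.1 t - logForm hρ.1 hσ.1 0
      - Real.log t * ρ.trace.re) Filter.atTop (nhds (relativeEntropy ρ σ)) := by
  have h := trace_cfc_mul_cfc hρ.1 hσ.1 (fun x => x) Real.log
  rw [cfc_id' ℝ ρ hρ.1.isSelfAdjoint] at h
  have h0 : logForm hρ.1 hσ.1 0 = (ρ * cfc Real.log σ).trace.re := by
    rw [h]
    simp [logForm]
  rw [relativeEntropy, ← h0]
  refine ((tendsto_logForm hρ hσ).sub_const _).congr fun t => ?_
  ring

/-- Joint convexity of the relative entropy. -/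
theorem relativeEntropy_sum_le {ι : Type*} (s : Finset ι) (w : ι → ℝ) (hw : ∀ k ∈ s, 0 ≤ w k)
    {ρ σ : ι → Matrix n n ℂ} (hρ : ∀ k, (ρ k).PosSemidef) (hσ : ∀ k, (σ k).PosDef)
    (hρs : (∑ k ∈ s, w k • ρ k).PosSemidef) (hσs : (∑ k ∈ s, w k • σ k).PosDef) :
    relativeEntropy (∑ k ∈ s, w k • ρ k) (∑ k ∈ s, w k • σ k)
      ≤ ∑ k ∈ s, w k * relativeEntropy (ρ k) (σ k) := by
  refine le_of_tendsto_of_tendsto (tendsto_logForm_sub hρs hσs)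
    (tendsto_finsetSum s fun k _ => (tendsto_logForm_sub (hρ k) (hσ k)).const_mul (w k)) ?_
  filter_upwards [Filter.eventually_ge_atTop (0 : ℝ)] with t ht
  have htr : (∑ k ∈ s, w k • ρ k).trace.re = ∑ k ∈ s, w k * (ρ k).trace.re := by
    simp [Matrix.trace_sum, Complex.re_sum]
  have h := logForm_sub_sum_le s w hw hρ hσ hρs hσs ht
  rw [htr, Finset.mul_sum]
  refine (sub_le_sub_right h _).trans_eq ?_
  rw [← Finset.sum_sub_distrib]
  exact Finset.sum_congr rfl fun k _ => by ring

end EigenbasisCalculus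

/-! ### Pinching -/

/-- The pinching of `ρ` along the labelling `g` of the basis: the entries between basis vectors
with different labels are set to zero. -/
def pinch {n K : Type*} [DecidableEq K] (g : n → K) (ρ : Matrix n n ℂ) : Matrix n n ℂ :=
  Matrix.of fun i j => if g i = g j then ρ i j else 0

lemma posDef_add_smul_one {n : Type*} [DecidableEq n] {ρ : Matrix n n ℂ}
    (hρ : ρ.PosSemidef) {ε : ℝ} (hε : 0 < ε) : (ρ + ε • (1 : Matrix n n ℂ)).PosDef :=
  Matrix.PosDef.posSemidef_add hρ (Matrix.PosDef.one.smul hε)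

section Pinching

variable {n K L : Type*} [DecidableEq K] [DecidableEq L]

lemma pinch_apply (g : n → K) (ρ : Matrix n n ℂ) (i j : n) :
    pinch g ρ i j = if g i = g j then ρ i j else 0 := rfl

lemma pinch_add (g : n → K) (ρ σ : Matrix n n ℂ) : pinch g (ρ + σ) = pinch g ρ + pinch g σ := by
  ext i j
  by_cases h : g i = g j <;> simp [pinch_apply, h]

lemma pinch_smul (g : n → K) (c : ℝ) (ρ : Matrix n n ℂ) : pinch g (c • ρ) = c • pinch g ρ := by
  ext i j
  by_cases h : g i = g j <;> simp [pinch_apply, h]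

lemma pinch_sum_smul {ι : Type*} (g : n → K) (s : Finset ι) (w : ι → ℝ)
    (ρ : ι → Matrix n n ℂ) : pinch g (∑ k ∈ s, w k • ρ k) = ∑ k ∈ s, w k • pinch g (ρ k) := by
  ext i j
  by_cases h : g i = g j <;> simp [pinch_apply, Matrix.sum_apply, h]

lemma pinch_one [DecidableEq n] (g : n → K) : pinch g (1 : Matrix n n ℂ) = 1 := by
  ext i j
  by_cases h : i = j
  · subst h
    simp [pinch_apply]
  · simp [pinch_apply, Matrix.one_apply_ne h]

lemma pinch_pinch_of_refines {f : n → K} {g : n → L} (hfg : ∀ i j, f i = f j → g i = g j)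
    (ρ : Matrix n n ℂ) : pinch f (pinch g ρ) = pinch f ρ := by
  ext i j
  by_cases h : f i = f j
  · simp [pinch_apply, h, hfg i j h]
  · simp [pinch_apply, h]

lemma Matrix.PosSemidef.pinch [Finite n] [Fintype K] (g : n → K) {ρ : Matrix n n ℂ}
    (hρ : ρ.PosSemidef) : (pinch g ρ).PosSemidef := by
  have h : _root_.pinch g ρ = Matrix.hadamard ((1 : Matrix K K ℂ).submatrix g g) ρ := by
    ext i j
    by_cases h : g i = g j
    · simp [pinch_apply, h, Matrix.one_apply]
    · simp [pinch_apply, h, Matrix.one_apply_ne h]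
  rw [h]
  exact (Matrix.PosSemidef.one.submatrix g).hadamard hρ

lemma continuous_pinch (g : n → K) : Continuous (pinch g) := by
  refine continuous_matrix fun i j => ?_
  by_cases h : g i = g j
  · simpa [pinch_apply, h] using continuous_id.matrix_elem i j
  · simpa [pinch_apply, h] using continuous_const

variable [Fintype n]

lemma trace_pinch_mul (g : n → K) (ρ σ : Matrix n n ℂ) :
    (pinch g ρ * σ).trace = (ρ * pinch g σ).trace := by
  simp only [Matrix.trace, Matrix.diag_apply, Matrix.mul_apply, pinch_apply]
  refine Finset.sum_congr rfl fun i _ => Finset.sum_congr rfl fun j _ => ?_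
  by_cases h : g i = g j
  · simp [h]
  · simp [h, Ne.symm h]

variable [DecidableEq n]

/-- A matrix is fixed by pinching iff it commutes with the projections onto the label classes, a
property inherited by its functional calculus. -/
lemma pinch_cfc_pinch (g : n → K) (f : ℝ → ℝ) (ρ : Matrix n n ℂ) :
    pinch g (cfc f (pinch g ρ)) = cfc f (pinch g ρ) := by
  ext i j
  rw [pinch_apply]
  split_ifs with h
  · rfl
  set D : Matrix n n ℂ := Matrix.diagonal fun l => if g l = g i then 1 else 0 with hD
  have hcomm : Commute (pinch g ρ) D := by
    refine Matrix.ext fun a b => ?_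
    rw [hD, Matrix.mul_diagonal, Matrix.diagonal_mul, pinch_apply]
    by_cases hab : g a = g b
    · simp [hab, mul_comm]
    · simp [hab]
  have h2 := congrFun (congrFun (Commute.cfc_real hcomm f).eq i) j
  rw [hD, Matrix.mul_diagonal, Matrix.diagonal_mul] at h2
  simpa [Ne.symm h] using h2

/-- The entropy gap between two pinchings, the second a refinement of the first, is a relative
entropy. -/
lemma vonNeumannEntropy_pinch_sub [Fintype K] [Fintype L] {f : n → K} {g : n → L}
    (hfg : ∀ i j, f i = f j → g i = g j) {ρ : Matrix n n ℂ} (hρ : ρ.PosSemidef) :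
    vonNeumannEntropy (pinch f ρ) - vonNeumannEntropy (pinch g ρ)
      = relativeEntropy (pinch g ρ) (pinch f ρ) / Real.log 2 := by
  have h : (pinch g ρ * cfc Real.log (pinch f ρ)).trace
      = (pinch f ρ * cfc Real.log (pinch f ρ)).trace := by
    rw [← pinch_cfc_pinch, ← trace_pinch_mul, pinch_pinch_of_refines hfg, pinch_cfc_pinch]
  rw [vonNeumannEntropy_eq_neg_trace_mul_log (hρ.pinch f).1,
    vonNeumannEntropy_eq_neg_trace_mul_log (hρ.pinch g).1, relativeEntropy, h]
  ring

lemma tendsto_vonNeumannEntropy_pinch_add [Fintype K] (g : n → K) {ρ : Matrix n n ℂ}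
    (hρ : ρ.PosSemidef) :
    Filter.Tendsto (fun ε : ℝ => vonNeumannEntropy (pinch g (ρ + ε • (1 : Matrix n n ℂ))))
      (nhdsWithin 0 (Set.Ioi 0)) (nhds (vonNeumannEntropy (pinch g ρ))) := by
  have hc : ContinuousOn (fun ε : ℝ => vonNeumannEntropy (pinch g (ρ + ε • (1 : Matrix n n ℂ))))
      (Set.Ici 0) := by
    refine continuousOn_vonNeumannEntropy.comp (Continuous.continuousOn ?_) fun ε hε => ?_
    · exact (continuous_pinch g).comp
        (continuous_const.add (continuous_id.smul continuous_const))
    · exact ((hρ.add (Matrix.PosSemidef.one.smul (show (0 : ℝ) ≤ ε from hε))).pinch g).1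
  have h := (hc 0 Set.self_mem_Ici).mono_left (nhdsWithin_mono 0 Set.Ioi_subset_Ici_self)
  simpa using h

/-- The entropy gap between two pinchings, the second a refinement of the first, is convex. -/
theorem vonNeumannEntropy_pinch_sub_sum_le [Fintype K] [Fintype L] {f : n → K} {g : n → L}
    (hfg : ∀ i j, f i = f j → g i = g j) {ι : Type*} (s : Finset ι) (w : ι → ℝ)
    (hw : ∀ k ∈ s, 0 ≤ w k) (hw1 : ∑ k ∈ s, w k = 1) {ρ : ι → Matrix n n ℂ}
    (hρ : ∀ k, (ρ k).PosSemidef) :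
    vonNeumannEntropy (pinch f (∑ k ∈ s, w k • ρ k))
        - vonNeumannEntropy (pinch g (∑ k ∈ s, w k • ρ k))
      ≤ ∑ k ∈ s, w k * (vonNeumannEntropy (pinch f (ρ k)) - vonNeumannEntropy (pinch g (ρ k))) := by
  have hsum : (∑ k ∈ s, w k • ρ k).PosSemidef :=
    Matrix.posSemidef_sum s fun k hk => (hρ k).smul (hw k hk)
  -- Relative entropy is used at positive definite states only, so `ε • 1` is added first.
  refine le_of_tendsto_of_tendsto
    ((tendsto_vonNeumannEntropy_pinch_add f hsum).sub (tendsto_vonNeumannEntropy_pinch_add g hsum))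
    (tendsto_finsetSum s fun k _ => ((tendsto_vonNeumannEntropy_pinch_add f (hρ k)).sub
      (tendsto_vonNeumannEntropy_pinch_add g (hρ k))).const_mul (w k)) ?_
  filter_upwards [self_mem_nhdsWithin] with ε hε
  have hε : 0 < ε := hε
  have hε1 : ∀ {ρ : Matrix n n ℂ}, ρ.PosSemidef → (ρ + ε • (1 : Matrix n n ℂ)).PosSemidef :=
    fun h => (posDef_add_smul_one h hε).posSemidef
  have hpd : ∀ {ρ : Matrix n n ℂ}, ρ.PosSemidef →
      (pinch f (ρ + ε • (1 : Matrix n n ℂ))).PosDef := fun h => by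
    rw [pinch_add, pinch_smul, pinch_one]
    exact posDef_add_smul_one (h.pinch f) hε
  have hadd : (∑ k ∈ s, w k • ρ k) + ε • (1 : Matrix n n ℂ)
      = ∑ k ∈ s, w k • (ρ k + ε • (1 : Matrix n n ℂ)) := by
    simp only [smul_add, Finset.sum_add_distrib]
    rw [← Finset.sum_smul, hw1, one_smul]
  simp only [vonNeumannEntropy_pinch_sub hfg (hε1 hsum), vonNeumannEntropy_pinch_sub hfg
    (hε1 (hρ _)), ← mul_div_assoc, ← Finset.sum_div]
  refine div_le_div_of_nonneg_right ?_ (Real.log_nonneg one_le_two)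
  have hg := (hε1 hsum).pinch g
  have hf := hpd hsum
  rw [hadd, pinch_sum_smul] at hg hf ⊢
  rw [pinch_sum_smul]
  exact relativeEntropy_sum_le s w hw (fun k => (hε1 (hρ k)).pinch g) (fun k => hpd (hρ k)) hg hf

end Pinching

/-! ### Duality between the environment and the two qubits -/

lemma vonNeumannEntropy_transpose {n : Type*} [Fintype n] [DecidableEq n] {ρ : Matrix n n ℂ}
    (hρ : ρ.IsHermitian) : vonNeumannEntropy ρᵀ = vonNeumannEntropy ρ := by
  have e := hρ.eq_mul_diagonal
  have hUU : star (hρ.eigenvectorUnitary : Matrix n n ℂ) * hρ.eigenvectorUnitary = 1 :=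
    Unitary.coe_star_mul_self _
  have hD : (Matrix.diagonal fun i => (hρ.eigenvalues i : ℂ)).IsHermitian := by
    rw [Matrix.isHermitian_diagonal_iff]
    intro i
    simp [IsSelfAdjoint]
  generalize (hρ.eigenvectorUnitary : Matrix n n ℂ) = U at *
  have hDT : (Matrix.diagonal fun i => (hρ.eigenvalues i : ℂ))ᵀ
      = Matrix.diagonal fun i => (hρ.eigenvalues i : ℂ) := Matrix.diagonal_transpose _
  generalize (Matrix.diagonal fun i => (hρ.eigenvalues i : ℂ)) = D at *
  have h1 : D * star U * U = D := by rw [Matrix.mul_assoc, hUU, Matrix.mul_one]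
  have h2 : Uᵀ * ((star U)ᵀ * Dᵀ) = Dᵀ := by
    rw [← Matrix.mul_assoc, ← Matrix.transpose_mul, hUU, Matrix.transpose_one, Matrix.one_mul]
  have e1 : ρ = U * (D * star U) := by rw [e, Matrix.mul_assoc]
  have e2 : ρᵀ = (star U)ᵀ * Dᵀ * Uᵀ := by
    rw [e, Matrix.transpose_mul, Matrix.transpose_mul, Matrix.mul_assoc]
  have s1 : vonNeumannEntropy ρ = vonNeumannEntropy D := by
    rw [e1, vonNeumannEntropy_mul_comm, h1]
    · rwa [← e1]
    · rwa [h1]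
  have s2 : vonNeumannEntropy ρᵀ = vonNeumannEntropy Dᵀ := by
    rw [e2, vonNeumannEntropy_mul_comm, h2]
    · rw [← e2]
      exact hρ.transpose
    · rw [h2]
      exact hD.transpose
  rw [s2, s1, hDT]

/-- The entropy of a classical register `g(O)` together with the pure conditional states `Φ o` of
the environment is the entropy of the Gram matrix of the `Φ o`, pinched along `g`: both are the two
marginals of one pure state. -/
lemma vonNeumannEntropy_blockDiagonal_pushClassical_ketbra {Ω K m : Type*} [Fintype Ω]
    [DecidableEq Ω] [Fintype K] [DecidableEq K] [Fintype m] [DecidableEq m] (g : Ω → K)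
    (Φ : Ω → m → ℂ) :
    vonNeumannEntropy (Matrix.blockDiagonal (pushClassical g fun o => ketbra (Φ o)))
      = vonNeumannEntropy (pinch g (Matrix.of fun o o' => ∑ e, Φ o e * star (Φ o' e))) := by
  set A : Matrix (m × K) Ω ℂ := Matrix.of fun ek o => if g o = ek.2 then Φ o ek.1 else 0 with hA
  have h1 : Matrix.blockDiagonal (pushClassical g fun o => ketbra (Φ o)) = A * Aᴴ := by
    ext ⟨e, k⟩ ⟨e', k'⟩
    rw [Matrix.blockDiagonal_apply, Matrix.mul_apply]
    simp only [pushClassical, Matrix.sum_apply, ketbra, Matrix.vecMulVec_apply, hA,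
      Matrix.of_apply, Matrix.conjTranspose_apply, Finset.sum_filter, Pi.star_apply]
    by_cases h : k = k'
    · subst h
      simp only [if_true]
      exact Finset.sum_congr rfl fun o _ => by split_ifs <;> simp
    · rw [if_neg h]
      refine (Finset.sum_eq_zero fun o _ => ?_).symm
      by_cases h1 : g o = k
      · simp [h1, h]
      · simp [h1]
  have h2 : pinch g (Matrix.of fun o o' => ∑ e, Φ o e * star (Φ o' e)) = (Aᴴ * A)ᵀ := by
    ext o o'
    rw [pinch_apply, Matrix.transpose_apply, Matrix.mul_apply, Fintype.sum_prod_type]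
    simp only [Matrix.of_apply, Matrix.conjTranspose_apply, hA]
    by_cases h : g o = g o'
    · rw [if_pos h]
      refine Finset.sum_congr rfl fun e _ => ?_
      rw [Finset.sum_eq_single (g o)]
      · simp [h, mul_comm]
      · intro k _ hk
        simp [Ne.symm hk]
      · simp
    · rw [if_neg h]
      refine (Finset.sum_eq_zero fun e _ => Finset.sum_eq_zero fun k _ => ?_).symm
      by_cases h1 : g o = k
      · have : ¬ g o' = k := fun h2 => h (h1.trans h2.symm)
        simp [this]
      · simp [h1]
  have hH1 : (A * Aᴴ).IsHermitian := Matrix.isHermitian_mul_conjTranspose_self A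
  have hH2 : (Aᴴ * A).IsHermitian := Matrix.isHermitian_conjTranspose_mul_self A
  rw [h1, h2, vonNeumannEntropy_transpose hH2, vonNeumannEntropy_mul_comm A Aᴴ hH1 hH2]

lemma zProj_kronecker_zProj (o : TwoQubit) :
    zProj o.1 ⊗ₖ zProj o.2 = Matrix.single o o (1 : ℂ) := by
  simp [zProj, Matrix.single_kronecker_single]

lemma measuredState_ketbra {E : Type*} [Fintype E] [DecidableEq E] (φ : TwoQubit × E → ℂ)
    (o : TwoQubit) : measuredState (ketbra φ) o = ketbra fun e => φ (o, e) := by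
  ext e e'
  rw [measuredState, zProj_kronecker_zProj, partialTraceLeft, Matrix.of_apply,
    Finset.sum_eq_single o]
  · rw [Matrix.mul_apply, Finset.sum_eq_single (o, e)]
    · simp [ketbra, Matrix.vecMulVec_apply]
    · rintro ⟨a, e₁⟩ _ h
      rw [Matrix.kroneckerMap_apply, Matrix.single_apply, Matrix.one_apply]
      have : ¬ ((o = o ∧ o = a) ∧ e = e₁) := fun ⟨⟨_, h1⟩, h2⟩ => h (by rw [h1, h2])
      by_cases h1 : o = a
      · have : e ≠ e₁ := fun h2 => h (by rw [h1, h2])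
        simp [this]
      · simp [h1]
    · simp
  · intro a _ h
    rw [Matrix.mul_apply]
    refine Finset.sum_eq_zero fun x _ => ?_
    rw [Matrix.kroneckerMap_apply, Matrix.single_apply]
    simp [Ne.symm h]
  · simp

lemma measuredPair_eq_ketbra {E : Type*} [Fintype E] [DecidableEq E] (φ : TwoQubit × E → ℂ)
    (o : Outcome) :
    measuredPair φ o = ketbra fun e : E × E => φ (o.1, e.1) * φ (o.2, e.2) := by
  rw [measuredPair, measuredState_ketbra, measuredState_ketbra]
  ext ⟨e, e₁⟩ ⟨e', e₁'⟩
  simp only [Matrix.kroneckerMap_apply, ketbra,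
    Matrix.vecMulVec_apply, Pi.star_apply, star_mul']
  ring

/-- The conditional entropy of the measurement outcomes given the environment, in terms of the
two-qubit state alone. -/
def pinchingGap {A B : Type*} [DecidableEq A] [DecidableEq B] (f : Outcome → A) (g : Outcome → B)
    (ρ : Matrix Outcome Outcome ℂ) : ℝ :=
  vonNeumannEntropy (pinch (fun o => (f o, g o)) ρ) - vonNeumannEntropy (pinch g ρ)

lemma condEntropy_measuredPair {E A B : Type*} [Fintype E] [DecidableEq E] [Fintype A]
    [DecidableEq A] [Fintype B] [DecidableEq B] (f : Outcome → A) (g : Outcome → B)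
    {φ : TwoQubit × E → ℂ} {σ : Matrix TwoQubit TwoQubit ℂ} (h : IsPurification φ σ) :
    condEntropy f g (measuredPair φ) = pinchingGap f g (σ ⊗ₖ σ) := by
  have hG : (Matrix.of fun o o' : Outcome => ∑ e : E × E,
      (φ (o.1, e.1) * φ (o.2, e.2)) * star (φ (o'.1, e.1) * φ (o'.2, e.2))) = σ ⊗ₖ σ := by
    rw [← h]
    ext o o'
    simp only [Matrix.of_apply, Matrix.kroneckerMap_apply, partialTraceRight, ketbra,
      Matrix.vecMulVec_apply, Pi.star_apply, Finset.sum_mul_sum, Fintype.sum_prod_type]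
    refine Finset.sum_congr rfl fun e _ => Finset.sum_congr rfl fun e' _ => ?_
    rw [star_mul']
    ring
  have hτ : measuredPair φ = fun o => ketbra fun e : E × E => φ (o.1, e.1) * φ (o.2, e.2) :=
    funext (measuredPair_eq_ketbra φ)
  rw [condEntropy, pinchingGap, hτ, vonNeumannEntropy_blockDiagonal_pushClassical_ketbra,
    vonNeumannEntropy_blockDiagonal_pushClassical_ketbra, hG]

/-! ### The discrete twirl -/

lemma sum_F2 {M : Type*} [AddCommMonoid M] (f : F2 → M) : ∑ x, f x = f 0 + f 1 :=
  Fin.sum_univ_two f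

lemma F2_eq_zero_or_one (a : F2) : a = 0 ∨ a = 1 := by
  revert a
  decide

lemma F2_one_add_one : (1 : F2) + 1 = 0 := by decide

/-- The sign `(-1)^a`. -/
def sign2 (a : F2) : ℂ := (-1 : ℂ) ^ a.val

lemma sign2_zero : sign2 0 = 1 := by simp [sign2]

lemma sign2_one : sign2 1 = -1 := by simp [sign2, ZMod.val_one]

lemma sign2_add (a b : F2) : sign2 (a + b) = sign2 a * sign2 b := by
  rcases F2_eq_zero_or_one a with rfl | rfl <;> rcases F2_eq_zero_or_one b with rfl | rfl <;>
    simp [sign2, F2_one_add_one, ZMod.val_one]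

lemma sign2_mul_self (a : F2) : sign2 a * sign2 a = 1 := by
  rw [← sign2_add, CharTwo.add_self_eq_zero]
  simp [sign2]

lemma star_sign2 (a : F2) : star (sign2 a) = sign2 a := by
  simp [sign2]

lemma pauliX_pow_apply (s i j : F2) : (pauliX ^ s.val) i j = if i = j + s then 1 else 0 := by
  rcases F2_eq_zero_or_one s with rfl | rfl
  · simp [Matrix.one_apply]
  · simp [ZMod.val_one, pauliX]

lemma pauliZ_pow (t : F2) : pauliZ ^ t.val = Matrix.diagonal fun a => sign2 (t * a) := by
  rcases F2_eq_zero_or_one t with rfl | rfl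
  · simp [sign2]
  · simp [ZMod.val_one, pauliZ, sign2]

lemma pauliXZ_kronecker_apply (s t : F2) (i j : TwoQubit) :
    (pauliXZ s t ⊗ₖ pauliXZ s t) i j =
      if i = j + (s, s) then sign2 (t * (j.1 + j.2)) else 0 := by
  rw [Matrix.kroneckerMap_apply, pauliXZ, pauliZ_pow, Matrix.mul_diagonal, Matrix.mul_diagonal,
    pauliX_pow_apply, pauliX_pow_apply, mul_add, sign2_add]
  simp only [Prod.ext_iff, Prod.fst_add, Prod.snd_add]
  by_cases h1 : i.1 = j.1 + s <;> by_cases h2 : i.2 = j.2 + s <;> simp [h1, h2]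

lemma isHermitian_pauliXZ_kronecker (s t : F2) :
    (pauliXZ s t ⊗ₖ pauliXZ s t).IsHermitian := by
  ext i j
  rw [Matrix.conjTranspose_apply, pauliXZ_kronecker_apply, pauliXZ_kronecker_apply]
  by_cases h : i = j + (s, s)
  · have h' : j = i + (s, s) := by rw [h, add_assoc, CharTwo.add_self_eq_zero, add_zero]
    rw [if_pos h, if_pos h', star_sign2, h]
    congr 2
    simp only [Prod.fst_add, Prod.snd_add]
    linear_combination (CharTwo.add_self_eq_zero s)
  · have h' : j ≠ i + (s, s) := fun h' => h (by
      rw [h', add_assoc, CharTwo.add_self_eq_zero, add_zero])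
    rw [if_neg h, if_neg h', star_zero]

/-- The conjugate of `σ` by `X^s Z^t ⊗ X^s Z^t`. -/
def pauliConj (p : F2 × F2) (σ : Matrix TwoQubit TwoQubit ℂ) : Matrix TwoQubit TwoQubit ℂ :=
  (pauliXZ p.1 p.2 ⊗ₖ pauliXZ p.1 p.2) * σ * (pauliXZ p.1 p.2 ⊗ₖ pauliXZ p.1 p.2)

lemma pauliConj_apply (p : F2 × F2) (σ : Matrix TwoQubit TwoQubit ℂ) (i j : TwoQubit) :
    pauliConj p σ i j = sign2 (p.2 * (i.1 + i.2)) * sign2 (p.2 * (j.1 + j.2)) *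
      σ (i + (p.1, p.1)) (j + (p.1, p.1)) := by
  rw [pauliConj, Matrix.mul_apply, Finset.sum_eq_single (j + (p.1, p.1)), Matrix.mul_apply,
    Finset.sum_eq_single (i + (p.1, p.1))]
  · rw [pauliXZ_kronecker_apply, pauliXZ_kronecker_apply, if_pos rfl, if_pos]
    · have : p.2 * ((i + (p.1, p.1)).1 + (i + (p.1, p.1)).2) = p.2 * (i.1 + i.2) := by
        simp only [Prod.fst_add, Prod.snd_add]
        linear_combination p.2 * (CharTwo.add_self_eq_zero p.1)
      rw [this]
      ring
    · rw [add_assoc, CharTwo.add_self_eq_zero, add_zero]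
  · intro k _ hk
    rw [pauliXZ_kronecker_apply, if_neg, zero_mul]
    intro h
    exact hk (by rw [h, add_assoc, CharTwo.add_self_eq_zero, add_zero])
  · simp
  · intro k _ hk
    rw [pauliXZ_kronecker_apply _ _ k, if_neg hk, mul_zero]
  · simp

lemma Matrix.PosSemidef.pauliConj {σ : Matrix TwoQubit TwoQubit ℂ} (hσ : σ.PosSemidef)
    (p : F2 × F2) : (pauliConj p σ).PosSemidef := by
  have h := hσ.mul_mul_conjTranspose_same (pauliXZ p.1 p.2 ⊗ₖ pauliXZ p.1 p.2)
  rwa [(isHermitian_pauliXZ_kronecker p.1 p.2).eq] at h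

lemma twirl_eq_sum (σ : Matrix TwoQubit TwoQubit ℂ) :
    twirl σ = (1 / 4 : ℂ) • ∑ p : F2 × F2, pauliConj p σ := by
  rw [twirl, Fintype.sum_prod_type]
  rfl

lemma twirl_kronecker_twirl (σ : Matrix TwoQubit TwoQubit ℂ) :
    twirl σ ⊗ₖ twirl σ = ∑ p : (F2 × F2) × (F2 × F2),
      (1 / 16 : ℝ) • (pauliConj p.1 σ ⊗ₖ pauliConj p.2 σ) := by
  ext i j
  simp only [twirl_eq_sum, Matrix.kroneckerMap_apply, Matrix.smul_apply, Matrix.sum_apply,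
    Fintype.sum_prod_type (f := fun p : (F2 × F2) × (F2 × F2) => _), smul_eq_mul]
  rw [mul_mul_mul_comm, Finset.sum_mul_sum, Finset.mul_sum]
  refine Finset.sum_congr rfl fun p _ => ?_
  rw [Finset.mul_sum]
  refine Finset.sum_congr rfl fun q _ => ?_
  rw [Complex.real_smul]
  push_cast
  ring

/-- Conjugation by a signed permutation preserves the entropy. -/
lemma vonNeumannEntropy_signed_perm {Ω : Type*} [Fintype Ω] [DecidableEq Ω] (π : Equiv.Perm Ω)
    (χ : Ω → ℂ) (hχ : ∀ o, χ o * χ o = 1) {M M' : Matrix Ω Ω ℂ} (hM : M.IsHermitian)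
    (hM' : M'.IsHermitian) (h : ∀ o o', M' o o' = χ o * χ o' * M (π o) (π o')) :
    vonNeumannEntropy M' = vonNeumannEntropy M := by
  set A : Matrix Ω Ω ℂ := Matrix.of fun o x => χ o * M (π o) x with hA
  set B : Matrix Ω Ω ℂ := Matrix.of fun x o => if x = π o then χ o else 0 with hB
  have h1 : A * B = M' := by
    ext o o'
    rw [Matrix.mul_apply, h, Finset.sum_eq_single (π o')]
    · simp only [hA, hB, Matrix.of_apply, if_true]
      ring
    · intro x _ hx
      simp [hB, hx]
    · simp
  have h2 : B * A = M := by
    ext x y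
    rw [Matrix.mul_apply, Finset.sum_eq_single (π.symm x)]
    · simp [hA, hB, ← mul_assoc, hχ]
    · intro o _ ho
      have : x ≠ π o := fun hx => ho (by rw [hx, Equiv.symm_apply_apply])
      simp [hB, this]
    · simp
  rw [← h1, ← h2]
  exact vonNeumannEntropy_mul_comm A B (h1 ▸ hM') (h2 ▸ hM)

/-- The effect on the outcomes of bit flips `X^s ⊗ X^s` on the first and `X^{s'} ⊗ X^{s'}` on the
second copy. -/
def shiftOutcome (s s' : F2) : Equiv.Perm Outcome := Equiv.addRight ((s, s), (s', s'))

lemma vonNeumannEntropy_pinch_pauliConj {K : Type*} [Fintype K] [DecidableEq K] (g : Outcome → K)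
    (hg : ∀ s s' o o', g (shiftOutcome s s' o) = g (shiftOutcome s s' o') ↔ g o = g o')
    {σ : Matrix TwoQubit TwoQubit ℂ} (hσ : σ.PosSemidef) (p q : F2 × F2) :
    vonNeumannEntropy (pinch g (pauliConj p σ ⊗ₖ pauliConj q σ))
      = vonNeumannEntropy (pinch g (σ ⊗ₖ σ)) := by
  refine vonNeumannEntropy_signed_perm (shiftOutcome p.1 q.1)
    (fun o => sign2 (p.2 * (o.1.1 + o.1.2)) * sign2 (q.2 * (o.2.1 + o.2.2))) (fun o => ?_)
    ((hσ.kronecker hσ).pinch g).1 (((hσ.pauliConj p).kronecker (hσ.pauliConj q)).pinch g).1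
    fun o o' => ?_
  · rw [mul_mul_mul_comm, sign2_mul_self, sign2_mul_self, one_mul]
  · simp only [pinch_apply, hg, Matrix.kroneckerMap_apply, pauliConj_apply]
    split_ifs with h
    · simp only [shiftOutcome, Equiv.coe_addRight, Prod.fst_add, Prod.snd_add]
      ring
    · rw [mul_zero]

/-- Twirling decreases the conditional entropies of outcomes whose level sets are permuted by
simultaneous bit flips. -/
theorem pinchingGap_twirl_le {A B : Type*} [Fintype A] [DecidableEq A] [Fintype B]
    [DecidableEq B] (f : Outcome → A) (g : Outcome → B)
    (hfg : ∀ s s' o o', (f (shiftOutcome s s' o), g (shiftOutcome s s' o))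
      = (f (shiftOutcome s s' o'), g (shiftOutcome s s' o')) ↔ (f o, g o) = (f o', g o'))
    (hg : ∀ s s' o o', g (shiftOutcome s s' o) = g (shiftOutcome s s' o') ↔ g o = g o')
    {σ : Matrix TwoQubit TwoQubit ℂ} (hσ : σ.PosSemidef) :
    pinchingGap f g (twirl σ ⊗ₖ twirl σ) ≤ pinchingGap f g (σ ⊗ₖ σ) := by
  have hcard : ∑ _p : (F2 × F2) × (F2 × F2), (1 / 16 : ℝ) = 1 := by
    simp
  rw [twirl_kronecker_twirl]
  refine (vonNeumannEntropy_pinch_sub_sum_le (f := fun o => (f o, g o)) (g := g)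
    (fun i j h => (Prod.ext_iff.mp h).2) Finset.univ (fun _ => (1 / 16 : ℝ))
    (fun _ _ => by norm_num) hcard
    (fun p => (hσ.pauliConj p.1).kronecker (hσ.pauliConj p.2))).trans_eq ?_
  simp only [vonNeumannEntropy_pinch_pauliConj (fun o => (f o, g o)) hfg hσ,
    vonNeumannEntropy_pinch_pauliConj g hg hσ]
  rw [← Finset.sum_mul, hcard, one_mul, pinchingGap]

lemma rvW1_shiftOutcome (s s' : F2) (o : Outcome) : rvW1 (shiftOutcome s s' o) = rvW1 o := by
  revert s s' o
  decide

lemma rvU1_shiftOutcome (s s' : F2) (o : Outcome) :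
    rvU1 (shiftOutcome s s' o) = rvU1 o + (s + s') := by
  revert s s' o
  decide

lemma rvU2_shiftOutcome (s s' : F2) (o : Outcome) :
    rvU2 (shiftOutcome s s' o) = rvU2 o + if rvW1 o = 0 then s' else 0 := by
  revert s s' o
  decide

theorem entropyU1U2_twirl_le {E E' : Type*} [Fintype E] [DecidableEq E] [Fintype E']
    [DecidableEq E'] {φ : TwoQubit × E → ℂ} {φ' : TwoQubit × E' → ℂ}
    {σ : Matrix TwoQubit TwoQubit ℂ} (hσ : σ.PosSemidef) (h : IsPurification φ σ)
    (h' : IsPurification φ' (twirl σ)) : entropyU1U2 φ' ≤ entropyU1U2 φ := by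
  rw [entropyU1U2, entropyU1U2, condEntropy_measuredPair _ _ h, condEntropy_measuredPair _ _ h']
  refine pinchingGap_twirl_le _ _ (fun s s' o o' => ?_) (fun s s' o o' => ?_) hσ
  · simp only [rvW1_shiftOutcome, rvU1_shiftOutcome, rvU2_shiftOutcome, Prod.mk.injEq,
      add_left_inj]
    refine and_congr_left fun hw => ?_
    rw [hw, add_left_inj]
  · simp only [rvW1_shiftOutcome]

theorem entropyU2_twirl_le {E E' : Type*} [Fintype E] [DecidableEq E] [Fintype E']
    [DecidableEq E'] {φ : TwoQubit × E → ℂ} {φ' : TwoQubit × E' → ℂ}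
    {σ : Matrix TwoQubit TwoQubit ℂ} (hσ : σ.PosSemidef) (h : IsPurification φ σ)
    (h' : IsPurification φ' (twirl σ)) : entropyU2 φ' ≤ entropyU2 φ := by
  rw [entropyU2, entropyU2, condEntropy_measuredPair _ _ h, condEntropy_measuredPair _ _ h']
  refine pinchingGap_twirl_le _ _ (fun s s' o o' => ?_) (fun s s' o o' => ?_) hσ
  · simp only [rvW1_shiftOutcome, rvU1_shiftOutcome, rvU2_shiftOutcome, Prod.mk.injEq,
      add_left_inj]
    refine and_congr_left fun hw => ?_
    rw [hw.1, add_left_inj]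
  · simp only [rvW1_shiftOutcome, rvU1_shiftOutcome, Prod.mk.injEq, add_left_inj]

/-- Averaging over the phase flips removes the entries between different parities; averaging over
the bit flips symmetrizes the remaining ones. -/
lemma twirl_apply (σ : Matrix TwoQubit TwoQubit ℂ) (i j : TwoQubit) :
    twirl σ i j = if i.1 + i.2 = j.1 + j.2 then
      (σ i j + σ (i + (1, 1)) (j + (1, 1))) / 2 else 0 := by
  rw [twirl_eq_sum, Matrix.smul_apply, Matrix.sum_apply, Fintype.sum_prod_type]
  have h0 : ((0 : F2), (0 : F2)) = 0 := rfl
  simp only [sum_F2, pauliConj_apply, h0, zero_mul, one_mul, add_zero, smul_eq_mul]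
  rcases F2_eq_zero_or_one (i.1 + i.2) with h | h <;>
    rcases F2_eq_zero_or_one (j.1 + j.2) with h' | h' <;>
    simp only [h, h', sign2_zero, sign2_one, if_true, zero_ne_one, one_ne_zero, if_false] <;> ring

lemma trace_twirl (σ : Matrix TwoQubit TwoQubit ℂ) : (twirl σ).trace = σ.trace := by
  simp only [Matrix.trace, Matrix.diag_apply, twirl_apply, if_true, Fintype.sum_prod_type, sum_F2,
    Prod.mk_add_mk, zero_add, F2_one_add_one]
  ring

lemma IsDensity.twirl {σ : Matrix TwoQubit TwoQubit ℂ} (hσ : IsDensity σ) :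
    IsDensity (twirl σ) := by
  refine ⟨?_, (trace_twirl σ).trans hσ.2⟩
  rw [twirl_eq_sum]
  refine (Matrix.posSemidef_sum _ fun p _ => hσ.1.pauliConj p).smul ?_
  exact div_nonneg zero_le_one (by norm_num)

/-! ### Bell-diagonal entries -/

lemma bellState_eq (x z a b : F2) : bellState x z (a, b) =
    if b = a + x then sign2 (z * a) / (Real.sqrt 2 : ℂ) else 0 := rfl

lemma sqrt_two_mul_sqrt_two : (Real.sqrt 2 : ℂ) * (Real.sqrt 2 : ℂ) = 2 := by
  rw [← Complex.ofReal_mul, Real.mul_self_sqrt zero_le_two]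
  norm_num

lemma star_bellState (x z : F2) (i : TwoQubit) : star (bellState x z i) = bellState x z i := by
  obtain ⟨a, b⟩ := i
  rw [bellState_eq]
  split_ifs
  · rw [star_div₀, star_sign2, Complex.star_def, Complex.conj_ofReal]
  · simp

lemma sign2_div_mul_sign2_div (a b : F2) :
    sign2 a / (Real.sqrt 2 : ℂ) * (sign2 b / (Real.sqrt 2 : ℂ)) = sign2 (a + b) / 2 := by
  rw [div_mul_div_comm, sqrt_two_mul_sqrt_two, sign2_add]

lemma star_bellState_dotProduct_mulVec (σ : Matrix TwoQubit TwoQubit ℂ) (x z : F2) :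
    star (bellState x z) ⬝ᵥ (σ *ᵥ bellState x z) =
      ∑ a, ∑ a', sign2 (z * a + z * a') / 2 * σ (a, a + x) (a', a' + x) := by
  simp only [dotProduct, Matrix.mulVec, Pi.star_apply, star_bellState, Fintype.sum_prod_type,
    bellState_eq, ite_mul, zero_mul, mul_ite, mul_zero, Finset.sum_ite_eq',
    Finset.mem_univ, if_true]
  refine Finset.sum_congr rfl fun a _ => ?_
  rw [Finset.mul_sum]
  refine Finset.sum_congr rfl fun a' _ => ?_
  rw [← sign2_div_mul_sign2_div]
  ring

lemma bellDiagonal_apply (P : F2 × F2 → ℝ) (a b a' b' : F2) :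
    bellDiagonal P (a, b) (a', b') = if a + b = a' + b' then
      ∑ z, sign2 (z * a + z * a') / 2 * (P (a + b, z) : ℂ) else 0 := by
  have hb : ∀ x a b : F2, b = a + x ↔ x = a + b := by decide
  simp only [bellDiagonal, Matrix.sum_apply, Matrix.smul_apply, ketbra, Matrix.vecMulVec_apply,
    Pi.star_apply, star_bellState]
  simp only [bellState_eq, smul_eq_mul, hb]
  split_ifs with h
  · rw [Finset.sum_eq_single (a + b)]
    · refine Finset.sum_congr rfl fun z _ => ?_
      rw [if_pos rfl, if_pos h, sign2_div_mul_sign2_div, mul_comm]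
    · intro x _ hx
      simp [hx]
    · simp
  · refine Finset.sum_eq_zero fun x _ => Finset.sum_eq_zero fun z _ => ?_
    by_cases h1 : x = a + b
    · have : ¬ x = a' + b' := fun h2 => h (h1.symm.trans h2)
      simp [this]
    · simp [h1]

lemma twirl_eq_bellDiagonal {σ : Matrix TwoQubit TwoQubit ℂ} {P : F2 × F2 → ℝ}
    (h : ∀ x z : F2, star (bellState x z) ⬝ᵥ (σ *ᵥ bellState x z) = (P (x, z) : ℂ)) :
    twirl σ = bellDiagonal P := by
  ext ⟨a, b⟩ ⟨a', b'⟩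
  rw [twirl_apply, bellDiagonal_apply]
  split_ifs with hab
  swap
  · rfl
  simp only [← h, star_bellState_dotProduct_mulVec, sum_F2]
  rcases F2_eq_zero_or_one a with rfl | rfl <;> rcases F2_eq_zero_or_one b with rfl | rfl <;>
    rcases F2_eq_zero_or_one a' with rfl | rfl <;> rcases F2_eq_zero_or_one b' with rfl | rfl <;>
    simp only [zero_add, add_zero, F2_one_add_one, one_ne_zero, zero_ne_one] at hab <;>
    simp only [zero_add, add_zero, F2_one_add_one, mul_zero, mul_one, sign2_zero, sign2_one,
      Prod.mk_add_mk] <;> ring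

lemma trace_bellDiagonal (P : F2 × F2 → ℝ) : (bellDiagonal P).trace = ((∑ k, P k : ℝ) : ℂ) := by
  simp only [Matrix.trace, Matrix.diag_apply, Fintype.sum_prod_type, bellDiagonal_apply, if_true,
    CharTwo.add_self_eq_zero, sign2_zero, sum_F2, zero_add, add_zero]
  push_cast
  ring

lemma isBellDiagonal_twirl {σ : Matrix TwoQubit TwoQubit ℂ} (hσ : IsDensity σ) :
    IsBellDiagonal (twirl σ) := by
  set P : F2 × F2 → ℝ := fun k => (star (bellState k.1 k.2) ⬝ᵥ (σ *ᵥ bellState k.1 k.2)).re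
  have hnn : ∀ x z : F2, 0 ≤ star (bellState x z) ⬝ᵥ (σ *ᵥ bellState x z) := fun x z =>
    hσ.1.dotProduct_mulVec_nonneg _
  have hP : ∀ x z : F2, star (bellState x z) ⬝ᵥ (σ *ᵥ bellState x z) = (P (x, z) : ℂ) :=
    fun x z => Complex.ext rfl (Complex.nonneg_iff.mp (hnn x z)).2.symm
  have htw := twirl_eq_bellDiagonal hP
  refine ⟨P, fun k => (Complex.nonneg_iff.mp (hnn k.1 k.2)).1, ?_, htw⟩
  have := trace_bellDiagonal P
  rw [← htw, trace_twirl, hσ.2] at this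
  exact_mod_cast this.symm

/-! ### Classical distributions -/

lemma distXY_eq (σ : Matrix TwoQubit TwoQubit ℂ) (o : TwoQubit) : distXY σ o = (σ o o).re := by
  rw [distXY, zProj_kronecker_zProj, Matrix.trace, Finset.sum_eq_single o]
  · simp
  · intro i _ hi
    simp [Matrix.mul_apply, Ne.symm hi]
  · simp

/-- The distribution of the parity `X + Y` of the raw bits of one copy. -/
def distParity (σ : Matrix TwoQubit TwoQubit ℂ) (c : F2) : ℝ :=
  (σ (0, c) (0, c)).re + (σ (1, 1 + c) (1, 1 + c)).re

lemma distParity_twirl (σ : Matrix TwoQubit TwoQubit ℂ) :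
    distParity (twirl σ) = distParity σ := by
  funext c
  have hc : (1 : F2) + c + 1 = c := by rw [add_right_comm, F2_one_add_one, zero_add]
  simp only [distParity, twirl_apply, if_true, Prod.mk_add_mk, zero_add, F2_one_add_one, hc,
    add_comm c 1]
  simp only [Complex.add_re, Complex.div_ofNat_re]
  ring

/-- `W₁` is the sum of the parities of the two copies. -/
lemma distW1_eq (σ : Matrix TwoQubit TwoQubit ℂ) (w : F2) :
    distW1 σ w = distParity σ 0 * distParity σ w + distParity σ 1 * distParity σ (1 + w) := by
  rw [distW1, Finset.sum_filter]
  rcases F2_eq_zero_or_one w with rfl | rfl <;>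
  · simp only [Fintype.sum_prod_type, sum_F2, rvW1, rvU1, rvV1, xi1,
      distOutcome, distXY_eq, distParity, zero_add, add_zero, F2_one_add_one, if_true, zero_ne_one,
      one_ne_zero, if_false]
    ring

/-- `W₁ = 0` means that both copies have the same parity, and then `W₂` is the parity of the
second copy. -/
lemma sum_distOutcome_eq (σ : Matrix TwoQubit TwoQubit ℂ) (w : F2) :
    ∑ o : Outcome with rvW1 o = 0 ∧ rvW2 o = w, distOutcome σ o = distParity σ w ^ 2 := by
  rw [Finset.sum_filter]
  rcases F2_eq_zero_or_one w with rfl | rfl <;>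
  · simp only [Fintype.sum_prod_type, sum_F2, rvW2, rvU2, rvV2, xi2, rvW1,
      rvU1, rvV1, xi1, distOutcome, distXY_eq, distParity, zero_add, add_zero, F2_one_add_one,
      if_true, zero_ne_one, one_ne_zero, if_false, and_true, and_false, and_self]
    ring

lemma distW1_congr {σ τ : Matrix TwoQubit TwoQubit ℂ} (h : distParity σ = distParity τ) :
    distW1 σ = distW1 τ := by
  funext w
  rw [distW1_eq, distW1_eq, h]

lemma distW2GivenW1Zero_congr {σ τ : Matrix TwoQubit TwoQubit ℂ}
    (h : distParity σ = distParity τ) : distW2GivenW1Zero σ = distW2GivenW1Zero τ := by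
  funext w
  rw [distW2GivenW1Zero, distW2GivenW1Zero, sum_distOutcome_eq, sum_distOutcome_eq,
    distW1_congr h, h]

/-- The even and the odd parity of one copy have total probability one, so two independent copies
have the same parity with probability at least one half. -/
lemma distW1_zero_pos {σ : Matrix TwoQubit TwoQubit ℂ} (hσ : σ.trace = 1) : 0 < distW1 σ 0 := by
  have h : distParity σ 0 + distParity σ 1 = 1 := by
    have := congrArg Complex.re hσ
    simp only [Matrix.trace, Matrix.diag_apply, Fintype.sum_prod_type, sum_F2, Complex.add_re,
      Complex.one_re] at this
    simp only [distParity, F2_one_add_one, add_zero]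
    linarith
  rw [distW1_eq, add_zero]
  nlinarith [sq_nonneg (distParity σ 0 - distParity σ 1)]

theorem keyRate_twirl_le {E E' : Type*} [Fintype E] [DecidableEq E] [Fintype E']
    [DecidableEq E'] {φ : TwoQubit × E → ℂ} {φ' : TwoQubit × E' → ℂ}
    {σ : Matrix TwoQubit TwoQubit ℂ} (hσ : σ.PosSemidef) (h : IsPurification φ σ)
    (h' : IsPurification φ' (twirl σ)) : keyRate (twirl σ) φ' ≤ keyRate σ φ := by
  rw [keyRate, keyRate, distW1_congr (distParity_twirl σ),
    distW2GivenW1Zero_congr (distParity_twirl σ)]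
  have h1 := entropyU1U2_twirl_le hσ h h'
  have h2 := entropyU2_twirl_le hσ h h'
  gcongr

/-! ### Existence of minima -/

/-- The key-rate formula as a function of the two-qubit state alone. -/
def stateKeyRate (σ : Matrix TwoQubit TwoQubit ℂ) : ℝ :=
  1 / 2 * max
    (pinchingGap (fun o => (rvU1 o, rvU2 o)) rvW1 (σ ⊗ₖ σ) - shannonEntropy (distW1 σ)
      - distW1 σ 0 * shannonEntropy (distW2GivenW1Zero σ))
    (pinchingGap rvU2 (fun o => (rvW1 o, rvU1 o)) (σ ⊗ₖ σ)
      - distW1 σ 0 * shannonEntropy (distW2GivenW1Zero σ))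

lemma keyRate_eq_stateKeyRate {E : Type*} [Fintype E] [DecidableEq E] {φ : TwoQubit × E → ℂ}
    {σ : Matrix TwoQubit TwoQubit ℂ} (h : IsPurification φ σ) :
    keyRate σ φ = stateKeyRate σ := by
  rw [keyRate, stateKeyRate, entropyU1U2, entropyU2, condEntropy_measuredPair _ _ h,
    condEntropy_measuredPair _ _ h]

open scoped MatrixOrder Matrix.Norms.L2Operator in
lemma exists_eq_conjTranspose_mul_self {n : Type*} [Fintype n] {σ : Matrix n n ℂ}
    (hσ : σ.PosSemidef) : ∃ B : Matrix n n ℂ, σ = Bᴴ * B := by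
  classical
  exact CStarAlgebra.nonneg_iff_eq_star_mul_self.mp hσ.nonneg

lemma exists_isPurification {σ : Matrix TwoQubit TwoQubit ℂ} (hσ : σ.PosSemidef) :
    ∃ (d : ℕ) (φ : TwoQubit × Fin d → ℂ), IsPurification φ σ := by
  obtain ⟨B, hB⟩ := exists_eq_conjTranspose_mul_self hσ
  let e := Fintype.equivFin TwoQubit
  refine ⟨_, fun xe => star (B (e.symm xe.2) xe.1), ?_⟩
  rw [IsPurification, hB]
  ext x x'
  rw [partialTraceRight, Matrix.of_apply, Matrix.mul_apply, ← e.symm.sum_comp]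
  simp [ketbra, Matrix.vecMulVec_apply]

lemma keyRateValues_eq_image {S : Set (Matrix TwoQubit TwoQubit ℂ)}
    (hS : ∀ σ ∈ S, IsDensity σ) : keyRateValues S = stateKeyRate '' S := by
  ext r
  constructor
  · rintro ⟨σ, hσ, d, φ, h, rfl⟩
    exact ⟨σ, hσ, (keyRate_eq_stateKeyRate h).symm⟩
  · rintro ⟨σ, hσ, rfl⟩
    obtain ⟨d, φ, h⟩ := exists_isPurification (hS σ hσ).1
    exact ⟨σ, hσ, d, φ, h, (keyRate_eq_stateKeyRate h).symm⟩

lemma stateKeyRate_twirl_le {σ : Matrix TwoQubit TwoQubit ℂ} (hσ : IsDensity σ) :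
    stateKeyRate (twirl σ) ≤ stateKeyRate σ := by
  obtain ⟨d, φ, h⟩ := exists_isPurification hσ.1
  obtain ⟨d', φ', h'⟩ := exists_isPurification hσ.twirl.1
  rw [← keyRate_eq_stateKeyRate h, ← keyRate_eq_stateKeyRate h']
  exact keyRate_twirl_le hσ.1 h h'

lemma continuous_shannonEntropy {K : Type*} [Fintype K] :
    Continuous (shannonEntropy (K := K)) :=
  continuous_finsetSum _ fun k _ => continuous_neg_mul_logb.comp (continuous_apply k)

lemma continuous_distParity (c : F2) : Continuous fun σ => distParity σ c := by
  unfold distParity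
  exact (Complex.continuous_re.comp (continuous_id.matrix_elem _ _)).add
    (Complex.continuous_re.comp (continuous_id.matrix_elem _ _))

lemma continuous_distW1 : Continuous distW1 := by
  refine continuous_pi fun w => ?_
  simp only [distW1_eq]
  exact ((continuous_distParity _).mul (continuous_distParity _)).add
    ((continuous_distParity _).mul (continuous_distParity _))

lemma continuousOn_distW2GivenW1Zero : ContinuousOn distW2GivenW1Zero {σ | IsDensity σ} := by
  refine continuousOn_pi.mpr fun w => ?_
  simp only [distW2GivenW1Zero, sum_distOutcome_eq]
  exact ((continuous_distParity w).pow 2).continuousOn.div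
    ((continuous_apply 0).comp continuous_distW1).continuousOn
    fun σ hσ => (distW1_zero_pos hσ.2).ne'

lemma continuousOn_pinchingGap {A B : Type*} [Fintype A] [DecidableEq A] [Fintype B]
    [DecidableEq B] (f : Outcome → A) (g : Outcome → B) :
    ContinuousOn (fun σ : Matrix TwoQubit TwoQubit ℂ => pinchingGap f g (σ ⊗ₖ σ))
      {σ | IsDensity σ} := by
  have hk : Continuous fun σ : Matrix TwoQubit TwoQubit ℂ => σ ⊗ₖ σ :=
    continuous_matrix fun i j =>
      (continuous_id.matrix_elem i.1 j.1).mul (continuous_id.matrix_elem i.2 j.2)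
  refine ContinuousOn.sub ?_ ?_
  · exact continuousOn_vonNeumannEntropy.comp ((continuous_pinch _).comp hk).continuousOn
      fun σ hσ => ((hσ.1.kronecker hσ.1).pinch _).1
  · exact continuousOn_vonNeumannEntropy.comp ((continuous_pinch _).comp hk).continuousOn
      fun σ hσ => ((hσ.1.kronecker hσ.1).pinch _).1

lemma continuousOn_stateKeyRate : ContinuousOn stateKeyRate {σ | IsDensity σ} := by
  have h1 : ContinuousOn (fun σ => shannonEntropy (distW1 σ)) {σ | IsDensity σ} :=
    (continuous_shannonEntropy.comp continuous_distW1).continuousOn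
  have h2 : ContinuousOn (fun σ => distW1 σ 0 * shannonEntropy (distW2GivenW1Zero σ))
      {σ | IsDensity σ} :=
    ((continuous_apply 0).comp continuous_distW1).continuousOn.mul
      (continuous_shannonEntropy.comp_continuousOn continuousOn_distW2GivenW1Zero)
  exact continuousOn_const.mul ((((continuousOn_pinchingGap _ _).sub h1).sub h2).sup
    ((continuousOn_pinchingGap _ _).sub h2))

/-- The density operators are the continuous image `B ↦ Bᴴ B` of the compact Frobenius unit
sphere. -/
lemma isCompact_setOf_isDensity :
    IsCompact {σ : Matrix TwoQubit TwoQubit ℂ | IsDensity σ} := by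
  have hbox : IsCompact {B : Matrix TwoQubit TwoQubit ℂ | ∀ i j,
      B i j ∈ Metric.closedBall 0 1} := by
    have := isCompact_univ_pi (X := fun _ : TwoQubit => TwoQubit → ℂ) fun _ =>
      isCompact_univ_pi (X := fun _ : TwoQubit => ℂ) fun _ =>
        isCompact_closedBall (0 : ℂ) 1
    simp only [Set.pi, Set.mem_univ, true_implies, Set.mem_ofPred_eq] at this
    exact this
  have hmul : Continuous fun B : Matrix TwoQubit TwoQubit ℂ => Bᴴ * B :=
    continuous_id.matrix_conjTranspose.matrix_mul continuous_id
  have hcl : IsClosed {B : Matrix TwoQubit TwoQubit ℂ | (Bᴴ * B).trace = 1} :=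
    isClosed_eq hmul.matrix_trace continuous_const
  have h : {σ : Matrix TwoQubit TwoQubit ℂ | IsDensity σ} = (fun B => Bᴴ * B) ''
      ({B | ∀ i j, B i j ∈ Metric.closedBall 0 1} ∩ {B | (Bᴴ * B).trace = 1}) := by
    ext σ
    constructor
    · rintro ⟨hσ, htr⟩
      obtain ⟨B, rfl⟩ := exists_eq_conjTranspose_mul_self hσ
      refine ⟨B, ⟨fun i j => ?_, htr⟩, rfl⟩
      have hsum : ∑ j, ∑ i, ‖B i j‖ ^ 2 = 1 := by
        have h := congrArg Complex.re htr
        simp only [Matrix.trace, Matrix.diag_apply, Matrix.mul_apply, Matrix.conjTranspose_apply,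
          Complex.re_sum, Complex.one_re, Complex.star_def, Complex.conj_mul'] at h
        exact_mod_cast h
      have h1 : ‖B i j‖ ^ 2 ≤ ∑ i, ‖B i j‖ ^ 2 :=
        Finset.single_le_sum (f := fun i => ‖B i j‖ ^ 2) (fun _ _ => sq_nonneg _)
          (Finset.mem_univ i)
      have h2 : ∑ i, ‖B i j‖ ^ 2 ≤ ∑ j, ∑ i, ‖B i j‖ ^ 2 :=
        Finset.single_le_sum (f := fun j => ∑ i, ‖B i j‖ ^ 2)
          (fun _ _ => Finset.sum_nonneg fun _ _ => sq_nonneg _) (Finset.mem_univ j)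
      rw [mem_closedBall_zero_iff]
      exact (sq_le_one_iff₀ (norm_nonneg _)).mp ((h1.trans h2).trans_eq hsum)
    · rintro ⟨B, ⟨_, htr⟩, rfl⟩
      exact ⟨Matrix.posSemidef_conjTranspose_mul_self B, htr⟩
  rw [h]
  exact (hbox.inter_right hcl).image hmul

lemma isCompact_compatibleStates {𝒜 : Type*} (M : 𝒜 → Matrix TwoQubit TwoQubit ℂ) (Q : 𝒜 → ℝ) :
    IsCompact (compatibleStates M Q) := by
  have h : compatibleStates M Q = {σ | IsDensity σ} ∩ ⋂ a, {σ | (M a * σ).trace = (Q a : ℂ)} := by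
    ext σ
    simp [compatibleStates]
  rw [h]
  exact isCompact_setOf_isDensity.inter_right (isClosed_iInter fun a =>
    isClosed_eq (continuous_const.matrix_mul continuous_id).matrix_trace continuous_const)

theorem exists_isLeast_keyRateValues {𝒜 : Type*} (M : 𝒜 → Matrix TwoQubit TwoQubit ℂ)
    (Q : 𝒜 → ℝ) (hne : (compatibleStates M Q).Nonempty)
    (htw : ∀ σ ∈ compatibleStates M Q, twirl σ ∈ compatibleStates M Q) :
    ∃ m : ℝ, IsLeast (keyRateValues (compatibleStates M Q)) m ∧
      IsLeast (keyRateValues {σ ∈ compatibleStates M Q | IsBellDiagonal σ}) m := by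
  obtain ⟨σ, hσ, hmin⟩ := (isCompact_compatibleStates M Q).exists_isMinOn hne
    (continuousOn_stateKeyRate.mono fun σ hσ => hσ.1)
  have hle : ∀ τ ∈ compatibleStates M Q, stateKeyRate (twirl σ) ≤ stateKeyRate τ := fun τ hτ =>
    (stateKeyRate_twirl_le hσ.1).trans (hmin hτ)
  rw [keyRateValues_eq_image fun τ hτ => hτ.1, keyRateValues_eq_image fun τ hτ => hτ.1.1]
  refine ⟨stateKeyRate (twirl σ), ⟨⟨_, htw σ hσ, rfl⟩, ?_⟩,
    ⟨⟨_, ⟨htw σ hσ, isBellDiagonal_twirl hσ.1⟩, rfl⟩, ?_⟩⟩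
  · rintro _ ⟨τ, hτ, rfl⟩
    exact hle τ hτ
  · rintro _ ⟨τ, hτ, rfl⟩
    exact hle τ hτ.1

/-! ### Error estimation in the six-state and BB84 protocols -/

lemma trace_mul_pauliConj (p : F2 × F2) (M σ : Matrix TwoQubit TwoQubit ℂ) :
    (M * pauliConj p σ).trace = (pauliConj p M * σ).trace := by
  rw [pauliConj, pauliConj, ← Matrix.mul_assoc, Matrix.trace_mul_comm]
  simp only [Matrix.mul_assoc]

/-- The twirl is self-adjoint for the trace pairing. -/
lemma trace_mul_twirl (M σ : Matrix TwoQubit TwoQubit ℂ) :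
    (M * twirl σ).trace = (twirl M * σ).trace := by
  rw [twirl_eq_sum, twirl_eq_sum, Matrix.mul_smul, Matrix.smul_mul, Matrix.mul_sum,
    Matrix.sum_mul, Matrix.trace_smul, Matrix.trace_smul, Matrix.trace_sum, Matrix.trace_sum]
  simp only [trace_mul_pauliConj]

lemma ketbra_star_apply {n : Type*} (v : n → ℂ) (k l : n) :
    ketbra (star v) k l = ketbra v l k := by
  simp only [ketbra, Matrix.vecMulVec_apply, Pi.star_apply, star_star]
  ring

lemma ketbra_qubitBasis_zero (a k l : F2) :
    ketbra (qubitBasis 0 a) k l = if k = a ∧ l = a then 1 else 0 := by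
  by_cases h : k = a <;> by_cases h' : l = a <;>
    simp [ketbra, Matrix.vecMulVec_apply, qubitBasis, h, h']

lemma ketbra_qubitBasis_one (a k l : F2) :
    ketbra (qubitBasis 1 a) k l = sign2 (a * k + a * l) / 2 := by
  have h : ∀ j, qubitBasis 1 a j = sign2 (a * j) / (Real.sqrt 2 : ℂ) := fun _ => rfl
  rw [ketbra, Matrix.vecMulVec_apply, Pi.star_apply, h, h, star_div₀, star_sign2,
    Complex.star_def, Complex.conj_ofReal, sign2_div_mul_sign2_div]

lemma ketbra_qubitBasis_two (a k l : F2) :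
    ketbra (qubitBasis 2 a) k l =
      sign2 (a * k + a * l) / 2 * (Complex.I ^ k.val * (-Complex.I) ^ l.val) := by
  have h : ∀ j, qubitBasis 2 a j = sign2 (a * j) * Complex.I ^ j.val / (Real.sqrt 2 : ℂ) :=
    fun _ => rfl
  rw [ketbra, Matrix.vecMulVec_apply, Pi.star_apply, h, h, star_div₀, star_mul', star_sign2,
    star_pow, ← sign2_div_mul_sign2_div]
  simp only [Complex.star_def, Complex.conj_ofReal, Complex.conj_I]
  ring

lemma sum_ketbra_qubitBasis (b : Fin 3) :
    ketbra (qubitBasis b 0) + ketbra (qubitBasis b 1) = 1 := by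
  ext k l
  rw [Matrix.add_apply]
  fin_cases b <;> rcases F2_eq_zero_or_one k with rfl | rfl <;>
    rcases F2_eq_zero_or_one l with rfl | rfl <;>
    simp [ketbra_qubitBasis_zero, ketbra_qubitBasis_one, ketbra_qubitBasis_two, sign2_zero,
      sign2_one, F2_one_add_one, ZMod.val_one] <;> ring

lemma posSemidef_ketbra {n : Type*} [Fintype n] (v : n → ℂ) : (ketbra v).PosSemidef :=
  Matrix.posSemidef_vecMulVec_self_star v

lemma ketbra_star {n : Type*} (v : n → ℂ) : ketbra (star v) = (ketbra v)ᵀ :=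
  Matrix.ext fun k l => ketbra_star_apply v k l

theorem isPOVM_errorPOVM {r : Fin 3 → ℝ} (hr : ∀ b, 0 ≤ r b) (hr1 : ∑ b, r b = 1) :
    IsPOVM (errorPOVM r) := by
  constructor
  · intro bd
    exact (Matrix.posSemidef_sum _ fun a _ => (posSemidef_ketbra _).kronecker
      (posSemidef_ketbra _)).smul (Complex.zero_le_real.mpr (hr bd.1))
  · have hb : ∀ b, errorPOVM r (b, 0) + errorPOVM r (b, 1) = (r b : ℂ) • 1 := by
      intro b
      have hT : (ketbra (qubitBasis b 0))ᵀ + (ketbra (qubitBasis b 1))ᵀ = 1 := by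
        rw [← Matrix.transpose_add, sum_ketbra_qubitBasis, Matrix.transpose_one]
      have h1 : (1 : Matrix TwoQubit TwoQubit ℂ) =
          (ketbra (qubitBasis b 0) + ketbra (qubitBasis b 1)) ⊗ₖ
            ((ketbra (qubitBasis b 0))ᵀ + (ketbra (qubitBasis b 1))ᵀ) := by
        rw [hT, sum_ketbra_qubitBasis, Matrix.one_kronecker_one]
      rw [errorPOVM, errorPOVM, ← smul_add, h1]
      simp only [sum_F2, add_zero, zero_add, F2_one_add_one, ketbra_star]
      rw [Matrix.add_kronecker, Matrix.kronecker_add, Matrix.kronecker_add]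
      congr 1
      abel
    rw [Fintype.sum_prod_type]
    simp only [sum_F2, hb]
    rw [← Finset.sum_smul, ← Complex.ofReal_sum, hr1, Complex.ofReal_one, one_smul]

/-- Each error operator is a combination of `1` and a Pauli correlation, both of which commute with
all `X^s Z^t ⊗ X^s Z^t`; here the entries are compared directly. -/
lemma twirl_errorPOVM (r : Fin 3 → ℝ) (bd : Fin 3 × F2) :
    twirl (errorPOVM r bd) = errorPOVM r bd := by
  obtain ⟨b, d⟩ := bd
  have key : ∀ i j, errorPOVM r (b, d) i j = r b * ∑ a, ketbra (qubitBasis b a) i.1 j.1 *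
      ketbra (qubitBasis b (a + d)) j.2 i.2 := by
    intro i j
    simp only [errorPOVM, Matrix.smul_apply, Matrix.sum_apply, Matrix.kroneckerMap_apply,
      ketbra_star_apply, smul_eq_mul]
  ext ⟨x, y⟩ ⟨x', y'⟩
  rw [twirl_apply, key, key]
  simp only [sum_F2, Prod.mk_add_mk]
  rcases F2_eq_zero_or_one d with rfl | rfl <;> fin_cases b <;>
    rcases F2_eq_zero_or_one x with rfl | rfl <;> rcases F2_eq_zero_or_one y with rfl | rfl <;>
    rcases F2_eq_zero_or_one x' with rfl | rfl <;> rcases F2_eq_zero_or_one y' with rfl | rfl <;>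
    simp [ketbra_qubitBasis_zero, ketbra_qubitBasis_one, ketbra_qubitBasis_two, sign2_zero,
      sign2_one, F2_one_add_one, ZMod.val_one, -mul_eq_mul_left_iff, -mul_eq_zero, -zero_eq_mul] <;>
    ring

theorem twirl_mem_compatibleStates_errorPOVM (r : Fin 3 → ℝ) (Q : Fin 3 × F2 → ℝ)
    {σ : Matrix TwoQubit TwoQubit ℂ} (hσ : σ ∈ compatibleStates (errorPOVM r) Q) :
    twirl σ ∈ compatibleStates (errorPOVM r) Q :=
  ⟨hσ.1.twirl, fun bd => by rw [trace_mul_twirl, twirl_errorPOVM, hσ.2 bd]⟩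

end

theorem mainTheorem7 :
    -- fixed Bell-diagonal entries: the Bell-diagonal (twirled) state is the worst case
    (∀ (σ : Matrix TwoQubit TwoQubit ℂ) (P : F2 × F2 → ℝ), IsDensity σ →
      (∀ x z : F2, star (bellState x z) ⬝ᵥ (σ *ᵥ bellState x z) = (P (x, z) : ℂ)) →
        IsBellDiagonal (twirl σ) ∧ twirl σ = bellDiagonal P ∧
        distW1 (twirl σ) = distW1 σ ∧
        distW2GivenW1Zero (twirl σ) = distW2GivenW1Zero σ ∧
        (∀ (E E' : Type*) [Fintype E] [DecidableEq E] [Fintype E'] [DecidableEq E']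
          (φ : TwoQubit × E → ℂ) (φ' : TwoQubit × E' → ℂ),
          IsPurification φ σ → IsPurification φ' (twirl σ) →
            entropyU1U2 φ' ≤ entropyU1U2 φ ∧
            entropyU2 φ' ≤ entropyU2 φ ∧
            keyRate (twirl σ) φ' ≤ keyRate σ φ)) ∧
    -- the minimization over `Γ(Q)` may be restricted to Bell-diagonal states
    (∀ (𝒜 : Type*) [Fintype 𝒜] (M : 𝒜 → Matrix TwoQubit TwoQubit ℂ) (Q : 𝒜 → ℝ), IsPOVM M →
      (compatibleStates M Q).Nonempty →
      (∀ σ ∈ compatibleStates M Q, twirl σ ∈ compatibleStates M Q) →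
        ∃ m : ℝ, IsLeast (keyRateValues (compatibleStates M Q)) m ∧
          IsLeast (keyRateValues {σ ∈ compatibleStates M Q | IsBellDiagonal σ}) m) ∧
    -- this applies to the error estimation of the six-state and the BB84 protocols
    (∀ (r : Fin 3 → ℝ) (Q : Fin 3 × F2 → ℝ), (∀ b, 0 ≤ r b) → ∑ b, r b = 1 →
      IsPOVM (errorPOVM r) ∧
      (∀ σ ∈ compatibleStates (errorPOVM r) Q, twirl σ ∈ compatibleStates (errorPOVM r) Q) ∧
      ((compatibleStates (errorPOVM r) Q).Nonempty →
        ∃ m : ℝ, IsLeast (keyRateValues (compatibleStates (errorPOVM r) Q)) m ∧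
          IsLeast (keyRateValues {σ ∈ compatibleStates (errorPOVM r) Q | IsBellDiagonal σ}) m)) := by
  refine ⟨fun σ P hσ hP => ⟨isBellDiagonal_twirl hσ, twirl_eq_bellDiagonal hP,
      distW1_congr (distParity_twirl σ), distW2GivenW1Zero_congr (distParity_twirl σ), ?_⟩,
    fun 𝒜 _ M Q _ hne htw => exists_isLeast_keyRateValues M Q hne htw,
    fun r Q hr hr1 => ⟨isPOVM_errorPOVM hr hr1,
      fun σ hσ => twirl_mem_compatibleStates_errorPOVM r Q hσ,
      fun hne => exists_isLeast_keyRateValues _ Q hne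
        fun σ hσ => twirl_mem_compatibleStates_errorPOVM r Q hσ⟩⟩
  intro E E' _ _ _ _ φ φ' h h'
  exact ⟨entropyU1U2_twirl_le hσ.1 h h', entropyU2_twirl_le hσ.1 h h', keyRate_twirl_le hσ.1 h h'⟩
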